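/- Fix $\beta>0$ and $\bar\nu\ge 0$. For $N\ge 1$ let $\nabla^d:\mathbb R^N\to\mathbb R^{N-1}$, $(\nabla^d q)_i=N(q_{i+1}-q_i)$, $1\le i\le N-1$, be the discrete gradient, $\Delta_d=-(\nabla^d)^T\nabla^d$ the discrete Neumann Laplacian, $M=\mathrm{Id}-\bar\nu^2\Delta_d$ the penalized mass matrix, $\beta_N=\beta/N$, and $$H(p,q)=\tfrac12 p^TM^{-1}p+\tfrac12\sum_{i=1}^{N-1}(\nabla^d_i q)^2,\qquad (p,q)\in\mathbb R^N\times\mathbb R^N,$$ the mass-penalized Hamiltonian of the harmonic chain without exterior potential. Let $\delta t_N>0$ be time steps, and let $(p_1,q_1)$ be obtained from $(p,q)$ by one leapfrog step $$p_{1/2}=p+\tfrac{\delta t_N}{2}\Delta_d q,\qquad q_1=q+\delta t_N M^{-1}p_{1/2},\qquad p_1=p_{1/2}+\tfrac{\delta t_N}{2}\Delta_d q_1 .$$ For each $N$ let the random state $(p,q)$ be distributed according to the canonical distribution of $H$ at inverse temperature $\beta_N$. Since $H$ is invariant under the global translations of $q$, this is understood modulo translations: $(p,r)=(p,\nabla^d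 q)$ has the probability density $Z^{-1}\exp\bigl(-\beta_N(\tfrac12p^TM^{-1}p+\tfrac12|r|^2)\bigr)$ with respect to $dp\,dr$ on $\mathbb R^N\times\mathbb R^{N-1}$, and the center of mass of $q$ is arbitrary. Put $\Delta H=H(p_1,q_1)-H(p,q)$. Then $\beta_N\Delta H$ is square integrable, and with $m_N=\mathbb E[\beta_N\Delta H]$ and $\sigma_N^2=\mathrm{Var}[\beta_N\Delta H]$, $$\frac{\beta_N\Delta H-m_N}{\sigma_N}\longrightarrow\mathcal N(0,1)\quad\text{in law as }N\to\infty .$$ Moreover, as $N\to\infty$: (i) (IMMP) if $\bar\nu>0$ and $\delta t_N=o(1)$, then $m_N\sim \dfrac{N\delta t_N^6}{32\bar\nu^6}$ and $\sigma_N^2\sim\dfrac{N\delta t_N^6}{16\bar\nu^6}$; (ii) (Verlet integration of the exact dynamics) if $\bar\nu=0$ and $\delta t_N=o(1/N)$, then $m_N\sim\tfrac58N^7\delta t_N^6$ and $\sigma_N^2\sim\tfrac54N^7\delta t_N^6$. -/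

import Mathlib

open MeasureTheory ProbabilityTheory Filter Asymptotics
open scoped Matrix ENNReal Topology

noncomputable section

namespace HarmonicChain

/-- The discrete gradient `ℝ^N → ℝ^(N-1)` of a chain of `N` particles with mesh `1/N` and free ends
(discrete Neumann conditions), as a matrix: `(∇ q)_i = N (q_{i+1} - q_i)`. -/
def discGrad (N : ℕ) : Matrix (Fin (N - 1)) (Fin N) ℝ :=
  Matrix.of fun i j =>
    (N : ℝ) * ((if (j : ℕ) = (i : ℕ) + 1 then 1 else 0) - (if (j : ℕ) = (i : ℕ) then 1 else 0))

/-- The matrix acts as the difference quotient `(q_{i+1} - q_i) / (1/N)`. -/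
theorem discGrad_mulVec (N : ℕ) (q : Fin N → ℝ) (i : Fin (N - 1)) :
    (discGrad N *ᵥ q) i = (q ⟨i + 1, by omega⟩ - q ⟨i, by omega⟩) / (1 / (N : ℝ)) := by
  have e1 : ∀ j : Fin N, ((j : ℕ) = (i : ℕ) + 1) ↔ j = ⟨i + 1, by omega⟩ := fun j => by
    simp [Fin.ext_iff]
  have e2 : ∀ j : Fin N, ((j : ℕ) = (i : ℕ)) ↔ j = ⟨i, by omega⟩ := fun j => by
    simp [Fin.ext_iff]
  simp only [Matrix.mulVec, dotProduct, discGrad, Matrix.of_apply, e1, e2, mul_assoc, sub_mul,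
    ← Finset.mul_sum, Finset.sum_sub_distrib, ite_mul, one_mul, zero_mul, Finset.sum_ite_eq',
    Finset.mem_univ, if_true, one_div, div_inv_eq_mul]
  ring

/-- The discrete Neumann Laplacian `Δ_d = -∇ᵀ ∇`. -/
def discLaplacian (N : ℕ) : Matrix (Fin N) (Fin N) ℝ :=
  -((discGrad N)ᵀ * discGrad N)

/-- The penalized mass matrix `M = Id - ν² Δ_d` (the identity for `ν = 0`). -/
def massMatrix (N : ℕ) (ν : ℝ) : Matrix (Fin N) (Fin N) ℝ :=
  1 - ν ^ 2 • discLaplacian N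

/-- Phase space `ℝ^N × ℝ^N`, with points `(p, q)`. -/
abbrev Phase (N : ℕ) : Type := (Fin N → ℝ) × (Fin N → ℝ)

/-- Phase space modulo global translations, with points `(p, r)`, where `r = ∇ q`. -/
abbrev ReducedPhase (N : ℕ) : Type := (Fin N → ℝ) × (Fin (N - 1) → ℝ)

/-- The projection `(p, q) ↦ (p, ∇ q)`, whose fibers are the orbits of the global translations
of the chain. -/
def reduce (N : ℕ) (x : Phase N) : ReducedPhase N :=
  (x.1, discGrad N *ᵥ x.2)

/-- The mass-penalized Hamiltonian as a function of `(p, r)`: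
`½ pᵀ M⁻¹ p + ∑_{i<N} r_i² / 2`. -/
def reducedHamiltonian (N : ℕ) (ν : ℝ) (y : ReducedPhase N) : ℝ :=
  1 / 2 * (y.1 ⬝ᵥ ((massMatrix N ν)⁻¹ *ᵥ y.1)) + ∑ i, y.2 i ^ 2 / 2

/-- The mass-penalized Hamiltonian of the harmonic chain without exterior potential,
`H(p, q) = ½ pᵀ M⁻¹ p + ∑_{i<N} (∇_i q)² / 2`. -/
def hamiltonian (N : ℕ) (ν : ℝ) (x : Phase N) : ℝ :=
  1 / 2 * (x.1 ⬝ᵥ ((massMatrix N ν)⁻¹ *ᵥ x.1)) + ∑ i, (discGrad N *ᵥ x.2) i ^ 2 / 2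

theorem reducedHamiltonian_reduce (N : ℕ) (ν : ℝ) (x : Phase N) :
    reducedHamiltonian N ν (reduce N x) = hamiltonian N ν x := rfl

/-- The rescaled inverse temperature `β_N = β / N`. -/
def invTemp (β : ℝ) (N : ℕ) : ℝ := β / N

/-- The partition function `∫ exp(-β_N H) dp dr`. -/
def partitionFunction (N : ℕ) (ν β : ℝ) : ℝ≥0∞ :=
  ∫⁻ y : ReducedPhase N, ENNReal.ofReal (Real.exp (-(invTemp β N * reducedHamiltonian N ν y)))

/-- The canonical distribution `Z⁻¹ exp(-β_N H) dp dr` on the phase space modulo translations. -/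
def canonicalMeasure (N : ℕ) (ν β : ℝ) : Measure (ReducedPhase N) :=
  (partitionFunction N ν β)⁻¹ • (volume : Measure (ReducedPhase N)).withDensity
    fun y => ENNReal.ofReal (Real.exp (-(invTemp β N * reducedHamiltonian N ν y)))

/-- The random state `X = (p, q)` is canonically distributed. Since `H` is invariant under global
translations `q ↦ q + c (1, …, 1)`, the density `exp(-β_N H)` is not integrable on `ℝ^N × ℝ^N`, and
the canonical distribution is the normalized Gibbs measure modulo translations; the law of the
center of mass of `q`, given the rest, is left arbitrary. -/
structure IsCanonical {Ω : Type*} [MeasurableSpace Ω] (N : ℕ) (ν β : ℝ) (X : Ω → Phase N)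
    (P : Measure Ω) : Prop where
  aemeasurable : AEMeasurable X P
  map_reduce : P.map (fun ω => reduce N (X ω)) = canonicalMeasure N ν β

/-- One step of the leapfrog (Verlet) scheme with time step `dt`:
`p' = p + (dt/2) Δ_d q`, `q₁ = q + dt M⁻¹ p'`, `p₁ = p' + (dt/2) Δ_d q₁`. -/
def leapfrog (N : ℕ) (ν dt : ℝ) (x : Phase N) : Phase N :=
  let pHalf := x.1 + (dt / 2) • (discLaplacian N *ᵥ x.2)
  let qNew := x.2 + dt • ((massMatrix N ν)⁻¹ *ᵥ pHalf)
  (pHalf + (dt / 2) • (discLaplacian N *ᵥ qNew), qNew)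

/-- The energy variation `β_N ΔH = β_N (H(p₁, q₁) - H(p, q))` over one leapfrog step, in units of
the temperature. -/
def energyVariation (N : ℕ) (ν β dt : ℝ) (x : Phase N) : ℝ :=
  invTemp β N * (hamiltonian N ν (leapfrog N ν dt x) - hamiltonian N ν x)

end HarmonicChain

end

namespace HarmonicChain

/-! ### Gaussian measures -/

/-! Choose `C` with `Cᵀ C = M⁻¹` and put `z = (C p, ∇q)`. Then `H = |z|²/2`, the canonical law makes
`√β_N z` standard Gaussian, and a leapfrog step is `z ↦ S z` with `S = (1 - U/2)(1 + Uᵀ)(1 - U/2)`,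
where the only nonzero block of `U` is `δt C∇ᵀ`, so that `U² = 0`. Diagonalizing `A = SᵀS - 1` gives
`β_N ΔH = ½ ∑ a_j w_j²` with independent standard Gaussian `w_j` (`exists_gaussian_coordinates`).
Hence `m_N = ½ tr A` and `σ_N² = ½ tr A²`, and no eigenvector is ever needed explicitly.

With `ω_i²` the eigenvalues of `(C∇ᵀ)(C∇ᵀ)ᵀ`, nilpotency and cyclicity of the trace give `m_N =
δt⁶/32 ∑ ω_i⁶` and `σ_N² = δt⁶/16 ∑ ω_i⁶ + δt¹²/512 ∑ ω_i¹²` (`trace_energyMatrix`,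
`trace_energyMatrix_sq`).

Let `κ = 4N²/(1 + 4ν²N²)`. All `ω_i²` are at most `κ`, while their mean is at least `κ/4` for `N ≥
2`, so each power sum `∑ ω_i^(2k)` with `k ≥ 1` has order `N κ^k`. With `u = δt √κ`, a norm bound
yields `a_j² ≲ u⁶ + u¹²`, whereas `∑ a_j² ≳ N (u⁶ + u¹²)`. The normalized weights are thus
`O(N^(-1/2))` whatever the time steps, and the central limit theorem follows from characteristic
functions (`tendsto_prod_charFun`, `sq_div_sum_sq_le`).

Both regimes of the time step say `δt² κ → 0`, which makes the `δt¹²` term negligible. It remains to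
estimate `∑ ω_i⁶`. For `ν > 0`, `∑ (1 - ν²ω_i²) = tr M⁻¹` is bounded by a discrete Sobolev
inequality, so the sum is `N/ν⁶ + O(1)`. For `ν = 0`, `∇∇ᵀ = N²(2 - A)` with `A` the adjacency
matrix of a path, and counting closed walks gives `N⁶(20N - 32)`. -/

theorem pi_gaussianReal_eq_withDensity (ι : Type*) [Fintype ι] :
    Measure.pi (fun _ : ι => gaussianReal 0 1) =
      ENNReal.ofReal ((√(2 * Real.pi))⁻¹ ^ Fintype.card ι) •
        (volume : Measure (ι → ℝ)).withDensity
          fun w => ENNReal.ofReal (Real.exp (-(1 / 2 * ∑ i, w i ^ 2))) := by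
  refine Measure.pi_eq fun s hs => ?_
  have hprod : ∀ w : ι → ℝ, (Set.univ.pi s).indicator
      (fun w => ∏ i, gaussianPDFReal 0 1 (w i)) w
        = ∏ i, (s i).indicator (gaussianPDFReal 0 1) (w i) := by
    intro w
    by_cases hw : w ∈ Set.univ.pi s
    · rw [Set.indicator_of_mem hw]
      exact Finset.prod_congr rfl fun i _ => (Set.indicator_of_mem (hw i trivial) _).symm
    · rw [Set.indicator_of_notMem hw]
      obtain ⟨i, hi⟩ : ∃ i, w i ∉ s i := by simpa [Set.mem_pi] using hw
      exact (Finset.prod_eq_zero (Finset.mem_univ i) (Set.indicator_of_notMem hi _)).symm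
  have hpdf : ∀ w : ι → ℝ, ∏ i, gaussianPDFReal 0 1 (w i) =
      (√(2 * Real.pi))⁻¹ ^ Fintype.card ι * Real.exp (-(1 / 2 * ∑ i, w i ^ 2)) := by
    intro w
    simp only [gaussianPDFReal, Finset.prod_mul_distrib, ← Real.exp_sum]
    simp [Finset.mul_sum, ← Finset.sum_neg_distrib, div_eq_inv_mul]
  have hms : MeasurableSet (Set.univ.pi s) := MeasurableSet.univ_pi hs
  have hint : ∫ w in Set.univ.pi s, ∏ i, gaussianPDFReal 0 1 (w i)
      = ∏ i, ∫ x in s i, gaussianPDFReal 0 1 x := by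
    rw [← integral_indicator hms]
    simp_rw [hprod]
    rw [volume_pi, integral_fintype_prod_eq_prod
      (f := fun i => (s i).indicator (gaussianPDFReal 0 1))]
    exact Finset.prod_congr rfl fun i _ => integral_indicator (hs i)
  have hintg : Integrable (fun w : ι → ℝ => ∏ i, gaussianPDFReal 0 1 (w i)) := by
    rw [volume_pi]
    exact Integrable.fintype_prod fun i => integrable_gaussianPDFReal 0 1
  rw [Measure.smul_apply, withDensity_apply _ hms, smul_eq_mul,
    ← lintegral_const_mul _ (by fun_prop)]
  simp_rw [← ENNReal.ofReal_mul (show (0 : ℝ) ≤ (√(2 * Real.pi))⁻¹ ^ Fintype.card ι by positivity),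
    ← hpdf]
  rw [← ofReal_integral_eq_lintegral_ofReal hintg.integrableOn
    (ae_of_all _ fun w => Finset.prod_nonneg fun i _ => gaussianPDFReal_nonneg 0 1 _), hint,
    ENNReal.ofReal_prod_of_nonneg fun i _ =>
      integral_nonneg fun x => gaussianPDFReal_nonneg 0 1 x]
  exact Finset.prod_congr rfl fun i _ => (gaussianReal_apply_eq_integral 0 one_ne_zero _).symm

/-- Linear coordinates in which a Gibbs probability measure has the Hamiltonian `|w|² / 2` are
independent standard Gaussian variables. -/
theorem map_eq_pi_gaussianReal {ι V : Type*} [Fintype ι] [NormedAddCommGroup V]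
    [NormedSpace ℝ V] [MeasurableSpace V] [BorelSpace V] (ρ : Measure V) [ρ.IsAddHaarMeasure]
    (Φ : V ≃L[ℝ] (ι → ℝ)) (μ : Measure V) [IsProbabilityMeasure μ] (c : ℝ≥0∞)
    (hμ : μ = c • ρ.withDensity
      fun y => ENNReal.ofReal (Real.exp (-(1 / 2 * ∑ i, Φ y i ^ 2)))) :
    μ.map Φ = Measure.pi fun _ => gaussianReal 0 1 := by
  set g : (ι → ℝ) → ℝ≥0∞ := fun w => ENNReal.ofReal (Real.exp (-(1 / 2 * ∑ i, w i ^ 2)))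
  have hg : Measurable g := by fun_prop
  set κ : Measure (ι → ℝ) := volume.withDensity g
  have hΦ : Measurable Φ := Φ.continuous.measurable
  -- Uniqueness of Haar measure replaces the Jacobian: the constant `d` is never computed, since
  -- both measures compared at the end are probability multiples of `κ`.
  obtain ⟨d, hd⟩ : ∃ d : ℝ≥0∞, ρ.map Φ = d • (volume : Measure (ι → ℝ)) :=
    ⟨_, Measure.isAddLeftInvariant_eq_smul (ρ.map Φ) volume⟩
  have h1 : μ.map Φ = (c * d) • κ := by
    have : (ρ.withDensity (g ∘ Φ)).map Φ = (ρ.map Φ).withDensity g := by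
      ext s hs
      rw [Measure.map_apply hΦ hs, withDensity_apply _ (hΦ hs), withDensity_apply _ hs,
        setLIntegral_map hs hg hΦ]
      rfl
    rw [hμ, Measure.map_smul, mul_smul, show κ = volume.withDensity g from rfl,
      ← withDensity_smul_measure, ← hd, ← this]
    rfl
  have h2 := pi_gaussianReal_eq_withDensity ι
  set e : ℝ≥0∞ := ENNReal.ofReal ((√(2 * Real.pi))⁻¹ ^ Fintype.card ι)
  have hp1 : IsProbabilityMeasure (μ.map Φ) := Measure.isProbabilityMeasure_map hΦ.aemeasurable
  have e1 : c * d * κ Set.univ = 1 := by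
    have := hp1.measure_univ
    rwa [h1, Measure.smul_apply, smul_eq_mul] at this
  have e2 : e * κ Set.univ = 1 := by
    have := (inferInstance : IsProbabilityMeasure
      (Measure.pi fun _ : ι => gaussianReal 0 1)).measure_univ
    rwa [h2, Measure.smul_apply, smul_eq_mul] at this
  rw [h1, h2, ENNReal.eq_inv_of_mul_eq_one_left e1, ENNReal.eq_inv_of_mul_eq_one_left e2]

theorem integral_pow_four_gaussianReal : ∫ x, x ^ 4 ∂(gaussianReal 0 1) = 3 := by
  have h := iteratedDeriv_mgf_zero (X := id) (μ := gaussianReal 0 1) (by simp) 4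
  simp only [Pi.pow_apply, id_eq] at h
  rw [← h, mgf_id_gaussianReal, iteratedDeriv_succ, iteratedDeriv_succ, iteratedDeriv_succ,
    iteratedDeriv_one]
  have hE : ∀ t : ℝ,
      HasDerivAt (fun t : ℝ => Real.exp (t ^ 2 / 2)) (Real.exp (t ^ 2 / 2) * t) t := by
    intro t
    have := ((hasDerivAt_pow 2 t).div_const 2).exp
    simpa using this
  -- Differentiating the moment generating function `exp (t²/2)` only changes its polynomial factor,
  -- by `p ↦ p' + t p`.
  have key : ∀ (p : ℝ → ℝ) (p' t : ℝ), HasDerivAt p p' t →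
      deriv (fun t => p t * Real.exp (t ^ 2 / 2)) t = (p' + p t * t) * Real.exp (t ^ 2 / 2) := by
    intro p p' t hp
    have := (hp.fun_mul (hE t)).deriv
    rw [this]; ring
  have d0 : deriv (fun t : ℝ => Real.exp (0 * t + ((1 : NNReal) : ℝ) * t ^ 2 / 2)) =
      fun t => t * Real.exp (t ^ 2 / 2) := by
    ext t
    simpa [mul_comm] using (hE t).deriv
  have d1 : deriv (fun t : ℝ => t * Real.exp (t ^ 2 / 2)) =
      fun t => (1 + t * t) * Real.exp (t ^ 2 / 2) := by
    ext t
    exact key (fun t => t) 1 t (hasDerivAt_id' t)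
  have d2 : deriv (fun t : ℝ => (1 + t * t) * Real.exp (t ^ 2 / 2)) =
      fun t => (1 * t + t * 1 + (1 + t * t) * t) * Real.exp (t ^ 2 / 2) := by
    ext t
    exact key (fun t => 1 + t * t) _ t
      (((hasDerivAt_id' t).fun_mul (hasDerivAt_id' t)).const_add 1)
  rw [d0, d1, d2, key (fun t => 1 * t + t * 1 + (1 + t * t) * t) 3 0]
  · simp
  · have h2 := ((hasDerivAt_id' (0 : ℝ)).fun_mul (hasDerivAt_id' 0)).const_add 1
    have h3 := (((hasDerivAt_id' (0 : ℝ)).const_mul 1).fun_add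
      ((hasDerivAt_id' (0 : ℝ)).mul_const 1)).fun_add (h2.fun_mul (hasDerivAt_id' (0 : ℝ)))
    exact h3.congr_deriv (by norm_num)

theorem integral_sq_gaussianReal : ∫ x, x ^ 2 ∂(gaussianReal 0 1) = 1 := by
  have h := variance_id_gaussianReal (μ := 0) (v := 1)
  rw [variance_eq_integral (by fun_prop)] at h
  simpa using h

theorem memLp_sq_gaussianReal : MemLp (fun x : ℝ => x ^ 2) 2 (gaussianReal 0 1) := by
  rw [memLp_two_iff_integrable_sq (by fun_prop)]
  have := (memLp_id_gaussianReal (μ := 0) (v := 1) 4).integrable_norm_pow (by norm_num)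
  simpa [← pow_mul, pow_abs, abs_of_nonneg (show (0:ℝ) ≤ _ ^ 4 from Even.pow_nonneg (by decide) _)]
    using this

/-- The centered and normalized square of a standard Gaussian variable. -/
noncomputable def normSq (x : ℝ) : ℝ := (x ^ 2 - 1) / √2

theorem measurable_normSq : Measurable normSq := by
  unfold normSq
  fun_prop

theorem memLp_normSq : MemLp normSq 2 (gaussianReal 0 1) := by
  have := (memLp_sq_gaussianReal.sub (memLp_const (1 : ℝ))).mul_const (√2)⁻¹
  have e : normSq = fun x => (x ^ 2 - 1) * (√2)⁻¹ := by
    ext x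
    rw [normSq, div_eq_mul_inv]
  rw [e]
  exact this

theorem integral_normSq : ∫ x, normSq x ∂(gaussianReal 0 1) = 0 := by
  simp only [normSq]
  rw [integral_div, integral_sub (memLp_sq_gaussianReal.integrable (by norm_num))
    (integrable_const _), integral_sq_gaussianReal]
  simp

theorem integral_normSq_sq : ∫ x, normSq x ^ 2 ∂(gaussianReal 0 1) = 1 := by
  have h2 := memLp_sq_gaussianReal.integrable (show (1 : ℝ≥0∞) ≤ 2 by norm_num)
  have h4 : Integrable (fun x : ℝ => x ^ 4) (gaussianReal 0 1) := by
    simpa [← pow_mul] using memLp_sq_gaussianReal.integrable_sq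
  have : ∀ x, normSq x ^ 2 = (x ^ 4 - 2 * x ^ 2 + 1) / 2 := by
    intro x
    rw [normSq, div_pow, Real.sq_sqrt (by norm_num)]; ring
  simp_rw [this]
  have h42 : Integrable (fun x : ℝ => x ^ 4 - 2 * x ^ 2) (gaussianReal 0 1) :=
    h4.sub (h2.const_mul 2)
  rw [integral_div, integral_add h42 (integrable_const _), integral_sub h4 (h2.const_mul 2),
    integral_const_mul, integral_sq_gaussianReal,
    integral_pow_four_gaussianReal]
  norm_num

theorem variance_normSq : Var[normSq; gaussianReal 0 1] = 1 := by
  rw [variance_of_integral_eq_zero memLp_normSq.aestronglyMeasurable.aemeasurable integral_normSq,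
    integral_normSq_sq]

/-! ### A central limit theorem for weighted sums -/

/-- Telescoping: the factors are exchanged one at a time, and the others have norm at most one. -/
theorem norm_prod_sub_prod_le_sum {ι : Type*} (s : Finset ι) (f g : ι → ℂ)
    (hf : ∀ i ∈ s, ‖f i‖ ≤ 1) (hg : ∀ i ∈ s, ‖g i‖ ≤ 1) :
    ‖∏ i ∈ s, f i - ∏ i ∈ s, g i‖ ≤ ∑ i ∈ s, ‖f i - g i‖ := by
  classical
  induction s using Finset.induction_on with
  | empty => simp
  | insert a s ha ih =>
    rw [Finset.prod_insert ha, Finset.prod_insert ha, Finset.sum_insert ha]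
    have ih' := ih (fun i hi => hf i (Finset.mem_insert_of_mem hi))
      (fun i hi => hg i (Finset.mem_insert_of_mem hi))
    have hfs : ‖∏ i ∈ s, f i‖ ≤ 1 := by
      rw [norm_prod]
      exact Finset.prod_le_one (fun _ _ => norm_nonneg _)
        fun i hi => hf i (Finset.mem_insert_of_mem hi)
    have hga := hg a (Finset.mem_insert_self a s)
    calc ‖f a * ∏ i ∈ s, f i - g a * ∏ i ∈ s, g i‖
        = ‖(f a - g a) * ∏ i ∈ s, f i + g a * (∏ i ∈ s, f i - ∏ i ∈ s, g i)‖ := by ring_nf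
      _ ≤ ‖f a - g a‖ * ‖∏ i ∈ s, f i‖ + ‖g a‖ * ‖∏ i ∈ s, f i - ∏ i ∈ s, g i‖ := by
          refine (norm_add_le _ _).trans ?_
          rw [norm_mul, norm_mul]
      _ ≤ ‖f a - g a‖ * 1 + 1 * ∑ i ∈ s, ‖f i - g i‖ := by gcongr
      _ = _ := by ring

/-- Characteristic function form of the central limit theorem for weighted sums `∑ c_j Y_j` of
independent copies of a normalized variable, when the weights are uniformly small. -/
theorem tendsto_prod_charFun {ι : ℕ → Type*} [∀ n, Fintype (ι n)] {μ : Measure ℝ}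
    [IsProbabilityMeasure μ] (h0 : ∫ x, x ∂μ = 0) (h1 : ∫ x, x ^ 2 ∂μ = 1)
    (c : ∀ n, ι n → ℝ) (hsum : ∀ᶠ n in atTop, ∑ j, c n j ^ 2 = 1)
    (hmax : ∀ ε > 0, ∀ᶠ n in atTop, ∀ j, |c n j| ≤ ε) (t : ℝ) :
    Tendsto (fun n => ∏ j, charFun μ (c n j * t)) atTop
      (𝓝 (charFun (gaussianReal 0 1) t)) := by
  -- Both laws have mean 0 and second moment 1, so their characteristic functions share the
  -- expansion `1 - s²/2`.
  have hlo : (fun s => charFun μ s - charFun (gaussianReal 0 1) s) =o[𝓝 0] fun s : ℝ => s ^ 2 := by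
    have hμ := taylor_charFun_two (P := μ) (X := id) aemeasurable_id (by simpa using h0)
      (by simpa using h1)
    have hγ := taylor_charFun_two (P := gaussianReal 0 1) (X := id) aemeasurable_id
      (by simp) (by simpa using integral_sq_gaussianReal)
    simpa using hμ.sub hγ
  rw [Metric.tendsto_nhds]
  intro ε hε
  set η : ℝ := ε / (2 * (t ^ 2 + 1))
  have hη : 0 < η := by positivity
  obtain ⟨δ, hδ, hball⟩ := Metric.eventually_nhds_iff.1 (hlo.def hη)
  filter_upwards [hsum, hmax (δ / (2 * (|t| + 1))) (by positivity)] with n hn hm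
  -- As `∑ c_j² = 1`, the Gaussian limit factorizes along the same weights and can be compared
  -- factor by factor.
  have hγ : charFun (gaussianReal 0 1) t = ∏ j, charFun (gaussianReal 0 1) (c n j * t) := by
    simp_rw [charFun_gaussianReal]
    rw [← Complex.exp_sum]
    congr 1
    have : (∑ j, (c n j : ℂ) ^ 2) = 1 := by exact_mod_cast hn
    simp only [Complex.ofReal_zero, mul_zero, zero_mul, zero_sub, NNReal.coe_one,
      Complex.ofReal_one, one_mul, Complex.ofReal_mul, mul_pow]
    rw [Finset.sum_neg_distrib, ← Finset.sum_div, ← Finset.sum_mul, this, one_mul]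
  rw [hγ, dist_eq_norm]
  refine (norm_prod_sub_prod_le_sum _ _ _ (fun _ _ => norm_charFun_le_one _)
    (fun _ _ => norm_charFun_le_one _)).trans_lt ?_
  calc ∑ j, ‖charFun μ (c n j * t) - charFun (gaussianReal 0 1) (c n j * t)‖
      ≤ ∑ j, η * (c n j ^ 2 * t ^ 2) := by
        refine Finset.sum_le_sum fun j _ => ?_
        have hsmall : dist (c n j * t) 0 < δ := by
          rw [dist_zero_right, Real.norm_eq_abs, abs_mul]
          calc |c n j| * |t| ≤ δ / (2 * (|t| + 1)) * |t| := by gcongr; exact hm j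
            _ < δ := by
              rw [div_mul_eq_mul_div, div_lt_iff₀ (by positivity)]
              nlinarith [abs_nonneg t]
        have := hball hsmall
        rwa [Real.norm_of_nonneg (by positivity), mul_pow] at this
    _ = η * t ^ 2 := by rw [← Finset.mul_sum, ← Finset.sum_mul, hn, one_mul]
    _ < ε := by
        rw [div_mul_eq_mul_div, div_lt_iff₀ (by positivity)]
        nlinarith [sq_nonneg t]

/-! ### Diagonal quadratic forms of independent standard Gaussian variables -/

section GaussianQuadratic

variable {ι Ω : Type*} [Fintype ι] {w : Ω → ι → ℝ} {a : ι → ℝ} {F : Ω → ℝ}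

theorem quadratic_sub_mean (hF : ∀ ω, F ω = 1 / 2 * ∑ j, a j * w ω j ^ 2) (ω : Ω) :
    F ω = (∑ j, a j / √2 * normSq (w ω j)) + 1 / 2 * ∑ j, a j := by
  rw [hF, Finset.mul_sum, Finset.mul_sum, ← Finset.sum_add_distrib]
  refine Finset.sum_congr rfl fun j _ => ?_
  have h2 : √2 * √2 = (2 : ℝ) := Real.mul_self_sqrt (by norm_num)
  have : a j / √2 * normSq (w ω j) = a j * (w ω j ^ 2 - 1) / (√2 * √2) := by
    rw [normSq, div_mul_div_comm]
  rw [this, h2]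
  ring

variable [MeasurableSpace Ω] {P : Measure Ω}

theorem memLp_coord_sq (hw : AEMeasurable w P)
    (hlaw : P.map w = Measure.pi fun _ => gaussianReal 0 1) (j : ι) :
    MemLp (fun ω => w ω j ^ 2) 2 P := by
  have h1 : MemLp (fun x : ι → ℝ => x j ^ 2) 2 (Measure.pi fun _ : ι => gaussianReal 0 1) :=
    memLp_sq_gaussianReal.comp_measurePreserving (measurePreserving_eval _ j)
  rw [← hlaw] at h1
  exact h1.comp_of_map hw

theorem integral_coord_sq (hw : AEMeasurable w P)
    (hlaw : P.map w = Measure.pi fun _ => gaussianReal 0 1) (j : ι) :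
    ∫ ω, w ω j ^ 2 ∂P = 1 := by
  have h := integral_map (μ := Measure.pi fun _ : ι => gaussianReal 0 1)
    (f := fun x : ℝ => x ^ 2) (measurable_pi_apply j).aemeasurable
    (Measurable.aestronglyMeasurable (by fun_prop))
  rw [(measurePreserving_eval (fun _ : ι => gaussianReal 0 1) j).map_eq,
    integral_sq_gaussianReal] at h
  rw [← integral_map (f := fun x : ι → ℝ => x j ^ 2) hw
    (Measurable.aestronglyMeasurable (by fun_prop)), hlaw, h]

theorem memLp_quadratic (hw : AEMeasurable w P)
    (hlaw : P.map w = Measure.pi fun _ => gaussianReal 0 1)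
    (hF : ∀ ω, F ω = 1 / 2 * ∑ j, a j * w ω j ^ 2) : MemLp F 2 P := by
  rw [funext hF]
  exact (memLp_finsetSum _ fun j _ => (memLp_coord_sq hw hlaw j).const_mul (a j)).const_mul _

variable [IsProbabilityMeasure P]

theorem integral_quadratic (hw : AEMeasurable w P)
    (hlaw : P.map w = Measure.pi fun _ => gaussianReal 0 1)
    (hF : ∀ ω, F ω = 1 / 2 * ∑ j, a j * w ω j ^ 2) : ∫ ω, F ω ∂P = 1 / 2 * ∑ j, a j := by
  simp_rw [hF]
  rw [integral_const_mul, integral_finsetSum _ fun j _ =>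
    ((memLp_coord_sq hw hlaw j).integrable (by norm_num)).const_mul (a j)]
  simp_rw [integral_const_mul, integral_coord_sq hw hlaw, mul_one]

/-- Independent squares `w_j²` have variance 2, so each term contributes `(a_j/2)² · 2`. -/
theorem variance_quadratic (hw : AEMeasurable w P)
    (hlaw : P.map w = Measure.pi fun _ => gaussianReal 0 1)
    (hF : ∀ ω, F ω = 1 / 2 * ∑ j, a j * w ω j ^ 2) : Var[F; P] = 1 / 2 * ∑ j, a j ^ 2 := by
  set G : (ι → ℝ) → ℝ := ∑ j, fun x : ι → ℝ => (a j / √2) * normSq (x j)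
  have hmeas : ∀ j : ι, Measurable fun x : ι → ℝ => a j / √2 * normSq (x j) := fun j =>
    (measurable_normSq.comp (measurable_pi_apply j)).const_mul _
  have hG : Measurable G := by
    have := Finset.measurable_sum (f := fun j (x : ι → ℝ) => a j / √2 * normSq (x j))
      Finset.univ fun j _ => hmeas j
    convert this
    simp [G]
  have hFG : F = fun ω => (G ∘ w) ω + 1 / 2 * ∑ j, a j := by
    ext ω
    rw [quadratic_sub_mean hF]
    simp [G]
  rw [hFG, variance_add_const (hG.comp_aemeasurable hw).aestronglyMeasurable,
    ← variance_map hG.aemeasurable hw, hlaw,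
    variance_sum_pi (X := fun j x => a j / √2 * normSq x) fun j => memLp_normSq.const_mul _,
    Finset.mul_sum]
  refine Finset.sum_congr rfl fun j _ => ?_
  rw [variance_const_mul, variance_normSq, div_pow, Real.sq_sqrt (by norm_num)]
  ring

/-- The `√2` in `normSq` cancels the `½` in the variance, which leaves weights of unit Euclidean
norm when `a ≠ 0`; for `a = 0` the convention `x / 0 = 0` makes both sides 1. -/
theorem charFun_normalized_quadratic (hw : AEMeasurable w P)
    (hlaw : P.map w = Measure.pi fun _ => gaussianReal 0 1)
    (hF : ∀ ω, F ω = 1 / 2 * ∑ j, a j * w ω j ^ 2) (t : ℝ) :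
    charFun (P.map fun ω => (F ω - ∫ ω, F ω ∂P) / √(Var[F; P])) t =
      ∏ j, charFun ((gaussianReal 0 1).map normSq) (a j / √(∑ j, a j ^ 2) * t) := by
  set s : ℝ := √(∑ j, a j ^ 2)
  have hcoef : ∀ j, a j / √2 / √(Var[F; P]) = a j / s := by
    intro j
    rw [variance_quadratic hw hlaw hF, div_div, ← Real.sqrt_mul (by norm_num)]
    congr 2
    ring
  set X : ι → (ι → ℝ) → ℝ := fun j x => (a j / s) * normSq (x j)
  have hX : ∀ j, Measurable (X j) := fun j =>
    (measurable_normSq.comp (measurable_pi_apply j)).const_mul _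
  have hfun : (fun ω => (F ω - ∫ ω, F ω ∂P) / √(Var[F; P])) = (fun x => ∑ j, X j x) ∘ w := by
    ext ω
    rw [integral_quadratic hw hlaw hF, quadratic_sub_mean hF ω, add_sub_cancel_right,
      Finset.sum_div]
    refine Finset.sum_congr rfl fun j _ => ?_
    rw [mul_div_right_comm, hcoef]
  have hsumX : Measurable fun x => ∑ j, X j x := Finset.measurable_sum _ fun j _ => hX j
  have hind : iIndepFun X (Measure.pi fun _ : ι => gaussianReal 0 1) :=
    iIndepFun_pi (X := fun j x => a j / s * normSq x) fun j =>
      (measurable_normSq.const_mul _).aemeasurable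
  rw [hfun, ← AEMeasurable.map_map_of_aemeasurable hsumX.aemeasurable hw, hlaw,
    hind.charFun_map_fun_sum_eq_prod fun j => (hX j).aemeasurable, Finset.prod_apply]
  refine Finset.prod_congr rfl fun j _ => ?_
  have hcomp : X j = (fun x => a j / s * normSq x) ∘ fun x : ι → ℝ => x j := rfl
  rw [hcomp, ← Measure.map_map (measurable_normSq.const_mul _) (measurable_pi_apply j),
    (measurePreserving_eval (fun _ : ι => gaussianReal 0 1) j).map_eq, charFun_map_mul_comp
    measurable_normSq.aemeasurable]

end GaussianQuadratic

/-! ### Spectral decomposition of symmetric matrices -/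

section Spectral

variable {ι : Type*} [Fintype ι] [DecidableEq ι] {A : Matrix ι ι ℝ}

theorem spectral_mul (hA : A.IsHermitian) :
    A = (hA.eigenvectorUnitary : Matrix ι ι ℝ) * Matrix.diagonal hA.eigenvalues *
      (hA.eigenvectorUnitary : Matrix ι ι ℝ)ᵀ := by
  have := hA.spectral_theorem
  rw [Unitary.conjStarAlgAut_apply] at this
  exact this

theorem transpose_eigenvectorUnitary_mul (hA : A.IsHermitian) :
    (hA.eigenvectorUnitary : Matrix ι ι ℝ)ᵀ * (hA.eigenvectorUnitary : Matrix ι ι ℝ) = 1 :=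
  Matrix.UnitaryGroup.star_mul_self hA.eigenvectorUnitary

theorem trace_pow_eq_sum_eigenvalues (hA : A.IsHermitian) (k : ℕ) :
    (A ^ k).trace = ∑ i, hA.eigenvalues i ^ k := by
  set Q : Matrix ι ι ℝ := hA.eigenvectorUnitary.1
  have hQ : Qᵀ * Q = 1 := transpose_eigenvectorUnitary_mul hA
  have hQ' : Q * Qᵀ = 1 := mul_eq_one_comm.1 hQ
  have hAQ : A = Q * Matrix.diagonal hA.eigenvalues * Qᵀ := spectral_mul hA
  generalize hA.eigenvalues = d at hAQ ⊢
  have h : A ^ k = Q * Matrix.diagonal d ^ k * Qᵀ := by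
    induction k with
    | zero => rw [pow_zero, pow_zero, mul_one, hQ']
    | succ k ih =>
      rw [pow_succ, ih, pow_succ, hAQ]
      simp only [mul_assoc]
      rw [← mul_assoc Qᵀ Q, hQ, one_mul]
  rw [h, Matrix.trace_mul_comm, ← mul_assoc, hQ, one_mul, Matrix.diagonal_pow,
    Matrix.trace_diagonal]
  rfl

theorem dotProduct_mulVec_eq_sum (hA : A.IsHermitian) (z : ι → ℝ) :
    z ⬝ᵥ (A *ᵥ z) = ∑ j, hA.eigenvalues j *
      ((hA.eigenvectorUnitary : Matrix ι ι ℝ)ᵀ *ᵥ z) j ^ 2 := by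
  have hAQ := spectral_mul hA
  generalize hA.eigenvalues = d at hAQ ⊢
  generalize hA.eigenvectorUnitary.1 = Q at hAQ ⊢
  rw [hAQ, ← Matrix.mulVec_mulVec, ← Matrix.mulVec_mulVec, Matrix.dotProduct_mulVec,
    ← Matrix.mulVec_transpose]
  simp only [dotProduct, Matrix.mulVec_diagonal]
  exact Finset.sum_congr rfl fun j _ => by ring

theorem sum_sq_mulVec_of_transpose_mul {κ : Type*} [Fintype κ] {Q : Matrix κ ι ℝ}
    (hQ : Qᵀ * Q = 1) (z : ι → ℝ) : ∑ j, (Q *ᵥ z) j ^ 2 = ∑ j, z j ^ 2 := by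
  have : (Q *ᵥ z) ⬝ᵥ (Q *ᵥ z) = z ⬝ᵥ z := by
    rw [Matrix.dotProduct_mulVec, ← Matrix.mulVec_transpose, Matrix.mulVec_mulVec, hQ,
      Matrix.one_mulVec]
  simpa [dotProduct, sq] using this

open scoped Matrix.Norms.L2Operator in
theorem abs_eigenvalues_le_norm (hA : A.IsHermitian) (j : ι) : |hA.eigenvalues j| ≤ ‖A‖ := by
  have h := A.l2_opNorm_mulVec (hA.eigenvectorBasis j)
  rw [hA.mulVec_eigenvectorBasis] at h
  have h1 : ‖hA.eigenvectorBasis j‖ = 1 := hA.eigenvectorBasis.orthonormal.1 j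
  simpa [norm_smul, h1] using h

open scoped Matrix.Norms.L2Operator in
theorem norm_le_of_sum_sq_le (B : Matrix ι ι ℝ) {b : ℝ} (hb : 0 ≤ b)
    (h : ∀ z : ι → ℝ, ∑ i, (B *ᵥ z) i ^ 2 ≤ b ^ 2 * ∑ i, z i ^ 2) : ‖B‖ ≤ b := by
  rw [Matrix.cstar_norm_def]
  refine ContinuousLinearMap.opNorm_le_bound _ hb fun z => ?_
  have hz := h z.ofLp
  rw [EuclideanSpace.norm_eq, EuclideanSpace.norm_eq, ← Real.sqrt_sq hb,
    ← Real.sqrt_mul (sq_nonneg b)]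
  refine Real.sqrt_le_sqrt ?_
  simpa [Matrix.ofLp_toEuclideanCLM] using hz

end Spectral

/-! ### The leapfrog step as a matrix -/

section Step

variable {ι : Type*} [Fintype ι]

theorem transpose_mul_self_eq_zero {U : Matrix ι ι ℝ} (hU : U * U = 0) : Uᵀ * Uᵀ = 0 := by
  rw [← Matrix.transpose_mul, hU, Matrix.transpose_zero]

variable [DecidableEq ι]

/-- The leapfrog step `(1 - U/2) (1 + Uᵀ) (1 - U/2)` of the Hamiltonian `|z|² / 2`, in which `-U` is
the generator of the kicks and `Uᵀ` the generator of the drifts. -/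
noncomputable def stepMatrix (U : Matrix ι ι ℝ) : Matrix ι ι ℝ :=
  (1 - (1 / 2 : ℝ) • U) * (1 + Uᵀ) * (1 - (1 / 2 : ℝ) • U)

/-- The matrix of the quadratic form `|S z|² - |z|²`, where `S` is the leapfrog step. -/
noncomputable def energyMatrix (U : Matrix ι ι ℝ) : Matrix ι ι ℝ :=
  (stepMatrix U)ᵀ * stepMatrix U - 1

theorem isHermitian_energyMatrix (U : Matrix ι ι ℝ) : (energyMatrix U).IsHermitian := by
  simp [Matrix.IsHermitian, energyMatrix, Matrix.conjTranspose_eq_transpose_of_trivial,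
    Matrix.transpose_mul]

theorem dotProduct_energyMatrix_mulVec (U : Matrix ι ι ℝ) (z : ι → ℝ) :
    z ⬝ᵥ (energyMatrix U *ᵥ z) = ∑ i, (stepMatrix U *ᵥ z) i ^ 2 - ∑ i, z i ^ 2 := by
  rw [energyMatrix, Matrix.sub_mulVec, dotProduct_sub, Matrix.one_mulVec,
    ← Matrix.mulVec_mulVec, Matrix.dotProduct_mulVec, ← Matrix.mulVec_transpose,
    Matrix.transpose_transpose]
  simp [dotProduct, sq]

variable {U : Matrix ι ι ℝ}

/-- Since `U² = Uᵀ² = 0`, only alternating words in `U` and `Uᵀ` survive. Those of length one and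
two cancel, so the energy error is of third order in `U`. -/
theorem energyMatrix_eq (hU : U * U = 0) :
    energyMatrix U = (1 / 4 : ℝ) • ((U * Uᵀ) ^ 2 - (Uᵀ * U) ^ 2) + (1 / 16 : ℝ) • (Uᵀ * U) ^ 3 +
      (1 / 4 : ℝ) • (U * Uᵀ * U + Uᵀ * U * Uᵀ) -
      (1 / 8 : ℝ) • ((U * Uᵀ) ^ 2 * U + (Uᵀ * U) ^ 2 * Uᵀ) := by
  have hV := transpose_mul_self_eq_zero hU
  have hS : stepMatrix U = 1 - U + Uᵀ - (1 / 2 : ℝ) • (U * Uᵀ) - (1 / 2 : ℝ) • (Uᵀ * U) +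
      (1 / 4 : ℝ) • (U * (Uᵀ * U)) := by
    simp only [stepMatrix, mul_add, add_mul, mul_sub, sub_mul, mul_one, one_mul,
      Matrix.smul_mul, Matrix.mul_smul, hU, mul_assoc]
    module
  have hST : (stepMatrix U)ᵀ = 1 - Uᵀ + U - (1 / 2 : ℝ) • (U * Uᵀ) - (1 / 2 : ℝ) • (Uᵀ * U) +
      (1 / 4 : ℝ) • (Uᵀ * (U * Uᵀ)) := by
    rw [hS]
    simp [Matrix.transpose_mul, mul_assoc]
  rw [energyMatrix, hST, hS]
  generalize Uᵀ = V at hV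
  -- Products are associated to the right, so nilpotency is also needed in this form to kill words
  -- with a repeated letter inside.
  have hU' : ∀ x, U * (U * x) = 0 := fun x => by rw [← mul_assoc, hU, zero_mul]
  have hV' : ∀ x, V * (V * x) = 0 := fun x => by rw [← mul_assoc, hV, zero_mul]
  simp only [pow_succ, pow_zero, mul_add, add_mul, mul_sub, sub_mul, mul_one, one_mul,
      Matrix.smul_mul, Matrix.mul_smul, hU, hV, hU', hV', mul_assoc, mul_zero, smul_zero]
  module

/-- An alternating word of odd length begins and ends with `U`; cyclicity brings these two letters
together. -/
theorem trace_pow_mul_self_eq_zero (hU : U * U = 0) (V : Matrix ι ι ℝ) (k : ℕ) :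
    ((U * V) ^ (k + 1) * U).trace = 0 := by
  rw [Matrix.trace_mul_comm, pow_succ', ← mul_assoc, ← mul_assoc, hU, zero_mul, zero_mul,
    Matrix.trace_zero]

/-- `B` and `C` may be rectangular; the exponent `k + 1` is needed because the identity matrices on
the two sides may differ in size. -/
theorem trace_mul_pow_comm {κ : Type*} [Fintype κ] [DecidableEq κ] (B : Matrix ι κ ℝ)
    (C : Matrix κ ι ℝ) (k : ℕ) :
    ((B * C) ^ (k + 1)).trace = ((C * B) ^ (k + 1)).trace := by
  have h : ∀ k : ℕ, (B * C) ^ (k + 1) = B * ((C * B) ^ k * C) := by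
    intro k
    induction k with
    | zero => simp
    | succ k ih => rw [pow_succ, ih, pow_succ]; simp only [Matrix.mul_assoc]
  rw [h, Matrix.trace_mul_comm, Matrix.mul_assoc, pow_succ]

/-- The odd words are traceless and the two words of length four have equal traces and opposite
signs, so the mean is of sixth order although the error itself is of third order. -/
theorem trace_energyMatrix (hU : U * U = 0) :
    (energyMatrix U).trace = 1 / 16 * ((U * Uᵀ) ^ 3).trace := by
  have hV := transpose_mul_self_eq_zero hU
  have e1 := trace_pow_mul_self_eq_zero hU Uᵀ
  have e2 := trace_pow_mul_self_eq_zero hV U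
  have f1 := e1 0
  have f2 := e2 0
  rw [zero_add, pow_one] at f1 f2
  rw [energyMatrix_eq hU]
  simp only [Matrix.trace_add, Matrix.trace_sub, Matrix.trace_smul, e1 1, e2 1, f1, f2,
    trace_mul_pow_comm Uᵀ U 1, trace_mul_pow_comm Uᵀ U 2, smul_eq_mul]
  ring

theorem trace_energyMatrix_sq (hU : U * U = 0) :
    (energyMatrix U ^ 2).trace =
      1 / 8 * ((U * Uᵀ) ^ 3).trace + 1 / 256 * ((U * Uᵀ) ^ 6).trace := by
  have hV := transpose_mul_self_eq_zero hU
  have e1 := trace_pow_mul_self_eq_zero hU Uᵀ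
  have e2 := trace_pow_mul_self_eq_zero hV U
  have c := trace_mul_pow_comm Uᵀ U
  -- The words of length seven and eight cancel; those of length ten cancel only under the trace.
  have key : energyMatrix U ^ 2 =
      (1 / 16 : ℝ) • ((U * Uᵀ) ^ 3 + (Uᵀ * U) ^ 3) + (1 / 64 : ℝ) • (U * Uᵀ) ^ 5 -
      (1 / 64 : ℝ) • (Uᵀ * U) ^ 5 + (1 / 256 : ℝ) • (Uᵀ * U) ^ 6 +
      (1 / 64 : ℝ) • ((U * Uᵀ) ^ 4 * U + (Uᵀ * U) ^ 4 * Uᵀ) -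
      (1 / 128 : ℝ) • ((U * Uᵀ) ^ 5 * U + (Uᵀ * U) ^ 5 * Uᵀ) := by
    rw [energyMatrix_eq hU]
    generalize Uᵀ = V at hV
    have hU' : ∀ x, U * (U * x) = 0 := fun x => by rw [← mul_assoc, hU, zero_mul]
    have hV' : ∀ x, V * (V * x) = 0 := fun x => by rw [← mul_assoc, hV, zero_mul]
    simp only [pow_succ, pow_zero, mul_add, add_mul, mul_sub, sub_mul, one_mul,
        Matrix.smul_mul, Matrix.mul_smul, hU', hV', mul_assoc, mul_zero, smul_zero]
    module
  rw [key]
  simp only [Matrix.trace_add, Matrix.trace_sub, Matrix.trace_smul, e1 3, e2 3, e1 4, e2 4,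
    c 2, c 4, c 5, smul_eq_mul]
  ring

open scoped Matrix.Norms.L2Operator in
-- The bound keeps both extreme powers, without assuming `u` small, so as to match the two terms of
-- `trace_energyMatrix_sq` for every time step.
theorem norm_energyMatrix_le (hU : U * U = 0) {u : ℝ} (hu : ‖U‖ ≤ u) :
    ‖energyMatrix U‖ ≤ 2 * (u ^ 3 + u ^ 6) := by
  have hu0 : 0 ≤ u := (norm_nonneg _).trans hu
  have hv : ‖Uᵀ‖ ≤ u := by
    rw [← Matrix.conjTranspose_eq_transpose_of_trivial, Matrix.l2_opNorm_conjTranspose]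
    exact hu
  have h1 : ‖U * Uᵀ‖ ≤ u ^ 2 := (norm_mul_le _ _).trans (by rw [sq]; gcongr)
  have h2 : ‖Uᵀ * U‖ ≤ u ^ 2 := (norm_mul_le _ _).trans (by rw [sq]; gcongr)
  have p1 : ‖(U * Uᵀ) ^ 2‖ ≤ (u ^ 2) ^ 2 :=
    (norm_pow_le' _ (by norm_num)).trans (by gcongr)
  have p2 : ‖(Uᵀ * U) ^ 2‖ ≤ (u ^ 2) ^ 2 :=
    (norm_pow_le' _ (by norm_num)).trans (by gcongr)
  have p3 : ‖(Uᵀ * U) ^ 3‖ ≤ (u ^ 2) ^ 3 :=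
    (norm_pow_le' _ (by norm_num)).trans (by gcongr)
  have q1 : ‖U * Uᵀ * U‖ ≤ u ^ 2 * u := (norm_mul_le _ _).trans (by gcongr)
  have q2 : ‖Uᵀ * U * Uᵀ‖ ≤ u ^ 2 * u := (norm_mul_le _ _).trans (by gcongr)
  have r1 : ‖(U * Uᵀ) ^ 2 * U‖ ≤ (u ^ 2) ^ 2 * u := (norm_mul_le _ _).trans (by gcongr)
  have r2 : ‖(Uᵀ * U) ^ 2 * Uᵀ‖ ≤ (u ^ 2) ^ 2 * u := (norm_mul_le _ _).trans (by gcongr)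
  rw [energyMatrix_eq hU]
  calc _ ≤ (1 / 4 : ℝ) * ((u ^ 2) ^ 2 + (u ^ 2) ^ 2) + (1 / 16) * (u ^ 2) ^ 3 +
        (1 / 4) * (u ^ 2 * u + u ^ 2 * u) + (1 / 8) * ((u ^ 2) ^ 2 * u + (u ^ 2) ^ 2 * u) := by
        refine (norm_sub_le _ _).trans (add_le_add ((norm_add_le _ _).trans (add_le_add
          ((norm_add_le _ _).trans (add_le_add ?_ ?_)) ?_)) ?_)
        · rw [norm_smul, Real.norm_of_nonneg (by norm_num)]
          have := (norm_sub_le _ _).trans (add_le_add p1 p2)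
          gcongr
        · rw [norm_smul, Real.norm_of_nonneg (by norm_num)]
          gcongr
        · rw [norm_smul, Real.norm_of_nonneg (by norm_num)]
          have := (norm_add_le _ _).trans (add_le_add q1 q2)
          gcongr
        · rw [norm_smul, Real.norm_of_nonneg (by norm_num)]
          have := (norm_add_le _ _).trans (add_le_add r1 r2)
          gcongr
    _ ≤ 2 * (u ^ 3 + u ^ 6) := by
        have h3 : 0 ≤ u ^ 3 := by positivity
        have a4 : u ^ 4 ≤ u ^ 3 + u ^ 6 := by
          rcases le_total u 1 with h | h
          · nlinarith [mul_nonneg h3 (sub_nonneg.2 h), pow_nonneg hu0 6]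
          · have : u ^ 4 ≤ u ^ 6 := pow_le_pow_right₀ h (by norm_num)
            linarith
        have a5 : u ^ 5 ≤ u ^ 3 + u ^ 6 := by
          rcases le_total u 1 with h | h
          · have : u ^ 5 ≤ u ^ 3 := pow_le_pow_of_le_one hu0 h (by norm_num)
            linarith [pow_nonneg hu0 6]
          · have : u ^ 5 ≤ u ^ 6 := pow_le_pow_right₀ h (by norm_num)
            linarith
        nlinarith [pow_nonneg hu0 6]

end Step

/-! ### The mass matrix and its inverse -/

theorem discLaplacian_eq (N : ℕ) : discLaplacian N = -((discGrad N)ᵀ * discGrad N) := rfl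

theorem massMatrix_eq (N : ℕ) (ν : ℝ) :
    massMatrix N ν = 1 + ν ^ 2 • ((discGrad N)ᵀ * discGrad N) := by
  rw [massMatrix, discLaplacian, smul_neg, sub_neg_eq_add]

theorem dotProduct_massMatrix_mulVec (N : ℕ) (ν : ℝ) (u : Fin N → ℝ) :
    u ⬝ᵥ (massMatrix N ν *ᵥ u) = ∑ i, u i ^ 2 + ν ^ 2 * ∑ i, (discGrad N *ᵥ u) i ^ 2 := by
  rw [massMatrix_eq, Matrix.add_mulVec, dotProduct_add, Matrix.one_mulVec, Matrix.smul_mulVec,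
    dotProduct_smul, ← Matrix.mulVec_mulVec, Matrix.dotProduct_mulVec, ← Matrix.mulVec_transpose,
    Matrix.transpose_transpose]
  simp [dotProduct, sq]

theorem posDef_massMatrix (N : ℕ) (ν : ℝ) : (massMatrix N ν).PosDef := by
  rw [massMatrix_eq]
  refine Matrix.PosDef.one.add_posSemidef ?_
  have := Matrix.posSemidef_conjTranspose_mul_self (discGrad N)
  rw [Matrix.conjTranspose_eq_transpose_of_trivial] at this
  exact this.smul (sq_nonneg ν)

/-- A square root of the inverse mass matrix. -/
structure IsInvMassRoot (N : ℕ) (ν : ℝ) (C : Matrix (Fin N) (Fin N) ℝ) : Prop where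
  transpose_mul_self : Cᵀ * C = (massMatrix N ν)⁻¹

open scoped MatrixOrder Matrix.Norms.L2Operator in
theorem exists_isInvMassRoot (N : ℕ) (ν : ℝ) : ∃ C, IsInvMassRoot N ν C := by
  have h := (posDef_massMatrix N ν).inv.posSemidef
  obtain ⟨C, hC⟩ := CStarAlgebra.nonneg_iff_eq_star_mul_self.1 h.nonneg
  exact ⟨C, ⟨hC.symm⟩⟩

theorem isUnit_det_massMatrix (N : ℕ) (ν : ℝ) : IsUnit (massMatrix N ν).det :=
  (posDef_massMatrix N ν).det_pos.ne'.isUnit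

namespace IsInvMassRoot

variable {N : ℕ} {ν : ℝ} {C : Matrix (Fin N) (Fin N) ℝ}

theorem transpose_mul_mul (hC : IsInvMassRoot N ν C) : Cᵀ * (C * massMatrix N ν) = 1 := by
  rw [← mul_assoc, hC.transpose_mul_self, Matrix.nonsing_inv_mul _ (isUnit_det_massMatrix N ν)]

theorem mul_mul_transpose (hC : IsInvMassRoot N ν C) : C * massMatrix N ν * Cᵀ = 1 :=
  mul_eq_one_comm.1 hC.transpose_mul_mul

theorem mul_transpose_mul (hC : IsInvMassRoot N ν C) : massMatrix N ν * Cᵀ * C = 1 := by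
  rw [mul_assoc, hC.transpose_mul_self, Matrix.mul_nonsing_inv _ (isUnit_det_massMatrix N ν)]

theorem sum_sq_mulVec (hC : IsInvMassRoot N ν C) (p : Fin N → ℝ) :
    ∑ i, (C *ᵥ p) i ^ 2 = p ⬝ᵥ ((massMatrix N ν)⁻¹ *ᵥ p) := by
  rw [← hC.transpose_mul_self, ← Matrix.mulVec_mulVec, Matrix.dotProduct_mulVec p,
    ← Matrix.mulVec_transpose, Matrix.transpose_transpose]
  simp [dotProduct, sq]

theorem eq_zero_of_mulVec_eq_zero (hC : IsInvMassRoot N ν C) {p : Fin N → ℝ} (hp : C *ᵥ p = 0) :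
    p = 0 := by
  rw [← Matrix.one_mulVec p, ← hC.mul_transpose_mul, ← Matrix.mulVec_mulVec, hp,
    Matrix.mulVec_zero]

end IsInvMassRoot

/-! ### Bounds for the discrete gradient -/

theorem sum_sq_discGrad_le (N : ℕ) (q : Fin N → ℝ) :
    ∑ i, (discGrad N *ᵥ q) i ^ 2 ≤ 4 * (N : ℝ) ^ 2 * ∑ i, q i ^ 2 := by
  cases N with
  | zero => simp
  | succ n =>
    have h1 : ∑ i : Fin n, q i.succ ^ 2 ≤ ∑ i, q i ^ 2 := by
      rw [Fin.sum_univ_succ]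
      linarith [sq_nonneg (q 0)]
    have h2 : ∑ i : Fin n, q i.castSucc ^ 2 ≤ ∑ i, q i ^ 2 := by
      rw [Fin.sum_univ_castSucc]
      linarith [sq_nonneg (q (Fin.last n))]
    calc ∑ i, (discGrad (n + 1) *ᵥ q) i ^ 2
        ≤ ∑ i : Fin n, ((n + 1 : ℕ) : ℝ) ^ 2 * (2 * q i.succ ^ 2 + 2 * q i.castSucc ^ 2) := by
          refine Finset.sum_le_sum fun (i : Fin n) _ => ?_
          rw [discGrad_mulVec, one_div, div_inv_eq_mul, mul_pow, mul_comm]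
          change _ * (q i.succ - q i.castSucc) ^ 2 ≤ _
          gcongr
          nlinarith [sq_nonneg (q i.succ + q i.castSucc)]
      _ = ((n + 1 : ℕ) : ℝ) ^ 2 *
            (2 * ∑ i : Fin n, q i.succ ^ 2 + 2 * ∑ i : Fin n, q i.castSucc ^ 2) := by
          rw [← Finset.mul_sum, Finset.sum_add_distrib, ← Finset.mul_sum, ← Finset.mul_sum]
      _ ≤ ((n + 1 : ℕ) : ℝ) ^ 2 * (2 * ∑ i, q i ^ 2 + 2 * ∑ i, q i ^ 2) := by gcongr
      _ = _ := by ring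

/-- An upper bound for the squared frequencies of the mass-penalized chain. -/
noncomputable def freqBound (N : ℕ) (ν : ℝ) : ℝ := 4 * (N : ℝ) ^ 2 / (1 + 4 * ν ^ 2 * (N : ℝ) ^ 2)

theorem freqBound_nonneg (N : ℕ) (ν : ℝ) : 0 ≤ freqBound N ν := by
  unfold freqBound
  positivity

theorem freqBound_pos {N : ℕ} (hN : 0 < N) (ν : ℝ) : 0 < freqBound N ν := by
  unfold freqBound
  positivity

theorem mul_freqBound_le_one (N : ℕ) (ν : ℝ) : ν ^ 2 * freqBound N ν ≤ 1 := by
  unfold freqBound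
  rw [mul_div_assoc', div_le_one (by positivity)]
  linarith

/-- The function `x / (1 + ν² x)` is increasing, and the Rayleigh quotient of `∇ᵀ∇` is at most
`4N²`. -/
theorem sum_sq_discGrad_mulVec_le (N : ℕ) (ν : ℝ) (u : Fin N → ℝ) :
    ∑ i, (discGrad N *ᵥ u) i ^ 2 ≤ freqBound N ν * (u ⬝ᵥ (massMatrix N ν *ᵥ u)) := by
  rw [dotProduct_massMatrix_mulVec, freqBound, div_mul_eq_mul_div, le_div_iff₀ (by positivity)]
  linarith [sum_sq_discGrad_le N u]

/-- The rescaled coupling matrix `C ∇ᵀ` between momenta and elongations. -/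
noncomputable def coupling (N : ℕ) (C : Matrix (Fin N) (Fin N) ℝ) :
    Matrix (Fin N) (Fin (N - 1)) ℝ :=
  C * (discGrad N)ᵀ

namespace IsInvMassRoot

variable {N : ℕ} {ν : ℝ} {C : Matrix (Fin N) (Fin N) ℝ}

theorem sum_sq_coupling_transpose_le (hC : IsInvMassRoot N ν C) (P : Fin N → ℝ) :
    ∑ i, ((coupling N C)ᵀ *ᵥ P) i ^ 2 ≤ freqBound N ν * ∑ i, P i ^ 2 := by
  have h := sum_sq_discGrad_mulVec_le N ν (Cᵀ *ᵥ P)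
  have e : (Cᵀ *ᵥ P) ⬝ᵥ (massMatrix N ν *ᵥ (Cᵀ *ᵥ P)) = ∑ i, P i ^ 2 := by
    rw [Matrix.mulVec_transpose, ← Matrix.dotProduct_mulVec, ← Matrix.mulVec_transpose,
      Matrix.mulVec_mulVec, Matrix.mulVec_mulVec, hC.mul_mul_transpose, Matrix.one_mulVec]
    simp [dotProduct, sq]
  rwa [e, Matrix.mulVec_mulVec, show discGrad N * Cᵀ = (coupling N C)ᵀ by
    simp [coupling, Matrix.transpose_mul]] at h

theorem le_sum_sq_mulVec (hC : IsInvMassRoot N ν C) (d : Fin N → ℝ) :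
    (∑ i, d i ^ 2) / (1 + 4 * ν ^ 2 * (N : ℝ) ^ 2) ≤ ∑ i, (C *ᵥ d) i ^ 2 := by
  set R : ℝ := 1 + 4 * ν ^ 2 * (N : ℝ) ^ 2
  have hR : 0 < R := by positivity
  set M := massMatrix N ν
  -- This square encodes that `M ≤ R` implies `M⁻¹ ≥ R⁻¹`: expanded, it reads `|C d|² - 2 R⁻¹ |d|² +
  -- R⁻² d·Md ≥ 0`.
  have h0 : 0 ≤ (C *ᵥ d - R⁻¹ • (C *ᵥ (M *ᵥ d))) ⬝ᵥ (C *ᵥ d - R⁻¹ • (C *ᵥ (M *ᵥ d))) := by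
    rw [dotProduct]
    exact Finset.sum_nonneg fun i _ => mul_self_nonneg _
  have e1 : (C *ᵥ d) ⬝ᵥ (C *ᵥ (M *ᵥ d)) = ∑ i, d i ^ 2 := by
    rw [← Matrix.vecMul_transpose, ← Matrix.dotProduct_mulVec, Matrix.mulVec_mulVec,
      Matrix.mulVec_mulVec, mul_assoc, hC.transpose_mul_mul, Matrix.one_mulVec]
    simp [dotProduct, sq]
  have e2 : (C *ᵥ (M *ᵥ d)) ⬝ᵥ (C *ᵥ (M *ᵥ d)) = d ⬝ᵥ (M *ᵥ d) := by
    have h : Cᵀ *ᵥ (C *ᵥ (M *ᵥ d)) = d := by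
      rw [Matrix.mulVec_mulVec, Matrix.mulVec_mulVec, mul_assoc, hC.transpose_mul_mul,
        Matrix.one_mulVec]
    rw [Matrix.dotProduct_mulVec, ← Matrix.mulVec_transpose, h]
  have e3 : (C *ᵥ d) ⬝ᵥ (C *ᵥ d) = ∑ i, (C *ᵥ d) i ^ 2 := by simp [dotProduct, sq]
  rw [dotProduct_sub, sub_dotProduct, sub_dotProduct, dotProduct_smul, smul_dotProduct,
    dotProduct_smul, smul_dotProduct, dotProduct_comm (C *ᵥ (M *ᵥ d)) (C *ᵥ d), e1, e2, e3] at h0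
  have hM : d ⬝ᵥ (M *ᵥ d) ≤ R * ∑ i, d i ^ 2 := by
    rw [dotProduct_massMatrix_mulVec]
    nlinarith [mul_le_mul_of_nonneg_left (sum_sq_discGrad_le N d) (sq_nonneg ν)]
  have hM' : R⁻¹ * (R⁻¹ * (d ⬝ᵥ (M *ᵥ d))) ≤ R⁻¹ * ∑ i, d i ^ 2 := by
    have : R⁻¹ * (d ⬝ᵥ (M *ᵥ d)) ≤ ∑ i, d i ^ 2 := by
      rw [inv_mul_le_iff₀ hR]
      exact hM
    gcongr
  simp only [smul_eq_mul] at h0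
  rw [div_eq_inv_mul]
  linarith

end IsInvMassRoot

theorem discGrad_mul_transpose_apply (N : ℕ) (i j : Fin (N - 1)) :
    (discGrad N * (discGrad N)ᵀ) i j = (N : ℝ) ^ 2 * ((if i = j then 2 else 0) -
      ((if (j : ℕ) = i + 1 then 1 else 0) + (if (i : ℕ) = j + 1 then 1 else 0))) := by
  have h : (discGrad N * (discGrad N)ᵀ) i j = (discGrad N *ᵥ (discGrad N j)) i := rfl
  rw [h, discGrad_mulVec, one_div, div_inv_eq_mul]
  simp only [discGrad, Matrix.of_apply, Fin.ext_iff, add_left_inj, eq_comm (a := (i : ℕ) + 1)]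
  split_ifs <;> first | omega | ring

theorem sum_sq_discGrad_row (N : ℕ) (i : Fin (N - 1)) :
    ∑ j, discGrad N i j ^ 2 = 2 * (N : ℝ) ^ 2 := by
  have h := discGrad_mul_transpose_apply N i i
  simp only [Matrix.mul_apply, Matrix.transpose_apply, ← sq] at h
  rw [h]
  simp
  ring

/-! ### Moments of the squared frequencies -/

/-- The power sum `∑ ω_i ^ (2 k)` of the frequencies of the chain. -/
noncomputable def freqMoment (N : ℕ) (C : Matrix (Fin N) (Fin N) ℝ) (k : ℕ) : ℝ :=
  ((coupling N C * (coupling N C)ᵀ) ^ k).trace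

theorem isHermitian_coupling_mul_transpose (N : ℕ) (C : Matrix (Fin N) (Fin N) ℝ) :
    (coupling N C * (coupling N C)ᵀ).IsHermitian := by
  simp [Matrix.IsHermitian, Matrix.conjTranspose_eq_transpose_of_trivial, Matrix.transpose_mul]

/-- The squared frequencies of the chain. -/
noncomputable def freqSq (N : ℕ) (C : Matrix (Fin N) (Fin N) ℝ) : Fin N → ℝ :=
  (isHermitian_coupling_mul_transpose N C).eigenvalues

theorem freqMoment_eq_sum (N : ℕ) (C : Matrix (Fin N) (Fin N) ℝ) (k : ℕ) :
    freqMoment N C k = ∑ i, freqSq N C i ^ k :=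
  trace_pow_eq_sum_eigenvalues _ k

theorem transpose_coupling_mul_apply (N : ℕ) (C : Matrix (Fin N) (Fin N) ℝ) (i : Fin (N - 1)) :
    ((coupling N C)ᵀ * coupling N C) i i = ∑ j, (C *ᵥ discGrad N i) j ^ 2 := by
  rw [Matrix.mul_apply]
  refine Finset.sum_congr rfl fun j _ => ?_
  rw [Matrix.transpose_apply, sq]
  rfl

theorem freqSq_eq (N : ℕ) (C : Matrix (Fin N) (Fin N) ℝ) (i : Fin N) :
    ∃ v : Fin N → ℝ, ∑ j, v j ^ 2 = 1 ∧
      freqSq N C i = ∑ j, ((coupling N C)ᵀ *ᵥ v) j ^ 2 := by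
  have hA := isHermitian_coupling_mul_transpose N C
  refine ⟨(hA.eigenvectorBasis i).ofLp, ?_, ?_⟩
  · have h1 : ‖hA.eigenvectorBasis i‖ = 1 := hA.eigenvectorBasis.orthonormal.1 i
    rw [EuclideanSpace.norm_eq, Real.sqrt_eq_one] at h1
    simpa using h1
  · have h := hA.eigenvalues_eq i
    rw [freqSq, h, ← Matrix.mulVec_mulVec, star_trivial, Matrix.dotProduct_mulVec,
      ← Matrix.mulVec_transpose]
    simp [dotProduct, sq]

namespace IsInvMassRoot

variable {N : ℕ} {ν : ℝ} {C : Matrix (Fin N) (Fin N) ℝ}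

theorem freqSq_nonneg (i : Fin N) : 0 ≤ freqSq N C i := by
  obtain ⟨v, -, h⟩ := freqSq_eq N C i
  rw [h]
  exact Finset.sum_nonneg fun _ _ => sq_nonneg _

theorem freqSq_le (hC : IsInvMassRoot N ν C) (i : Fin N) : freqSq N C i ≤ freqBound N ν := by
  obtain ⟨v, hv, h⟩ := freqSq_eq N C i
  have := hC.sum_sq_coupling_transpose_le v
  rwa [← h, hv, mul_one] at this

theorem freqMoment_one_eq :
    freqMoment N C 1 = ∑ i, ∑ j, (C *ᵥ discGrad N i) j ^ 2 := by
  rw [freqMoment, pow_one, Matrix.trace_mul_comm, Matrix.trace]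
  exact Finset.sum_congr rfl fun i _ => transpose_coupling_mul_apply N C i

/-- Each of the `N - 1` rows of `∇` has squared norm `2N²`, and `M⁻¹ ≥ (1 + 4ν²N²)⁻¹`, so each
contributes at least half of the maximal squared frequency. -/
theorem le_freqMoment_one (hC : IsInvMassRoot N ν C) :
    freqBound N ν * ((N - 1 : ℕ) : ℝ) / 2 ≤ freqMoment N C 1 := by
  rw [freqMoment_one_eq]
  calc freqBound N ν * ((N - 1 : ℕ) : ℝ) / 2
      = ∑ i : Fin (N - 1), (∑ j, discGrad N i j ^ 2) / (1 + 4 * ν ^ 2 * (N : ℝ) ^ 2) := by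
        simp only [sum_sq_discGrad_row, Finset.sum_const, Finset.card_univ, Fintype.card_fin,
          nsmul_eq_mul, freqBound]
        ring
    _ ≤ _ := Finset.sum_le_sum fun i _ => hC.le_sum_sq_mulVec _

theorem freqMoment_le (hC : IsInvMassRoot N ν C) (k : ℕ) :
    freqMoment N C k ≤ N * freqBound N ν ^ k := by
  rw [freqMoment_eq_sum]
  calc ∑ i, freqSq N C i ^ k ≤ ∑ _i : Fin N, freqBound N ν ^ k :=
        Finset.sum_le_sum fun i _ => pow_le_pow_left₀ (freqSq_nonneg i) (hC.freqSq_le i) k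
    _ = _ := by simp

theorem freqMoment_nonneg (k : ℕ) : 0 ≤ freqMoment N C k := by
  rw [freqMoment_eq_sum]
  exact Finset.sum_nonneg fun i _ => pow_nonneg (freqSq_nonneg i) k

/-- The power mean inequality lifts the bound on the first moment; the 4 comes from `(N - 1)/2 ≥
N/4`. -/
theorem le_freqMoment (hC : IsInvMassRoot N ν C) (hN : 2 ≤ N) (k : ℕ) :
    N * (freqBound N ν / 4) ^ (k + 1) ≤ freqMoment N C (k + 1) := by
  have h1 : N * (freqBound N ν / 4) ≤ freqMoment N C 1 := by
    refine le_trans ?_ hC.le_freqMoment_one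
    have : (N : ℝ) ≤ 2 * ((N - 1 : ℕ) : ℝ) := by exact_mod_cast (by omega : N ≤ 2 * (N - 1))
    nlinarith [mul_le_mul_of_nonneg_left this (freqBound_nonneg N ν)]
  have h2 := pow_sum_div_card_le_sum_pow (s := Finset.univ) (f := freqSq N C)
    (fun i _ => freqSq_nonneg i) k
  have h3 : freqMoment N C 1 = ∑ i, freqSq N C i := by simp [freqMoment_eq_sum]
  have hN0 : (0 : ℝ) < N := by exact_mod_cast (by omega : 0 < N)
  rw [← h3, ← freqMoment_eq_sum, Finset.card_univ, Fintype.card_fin] at h2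
  refine le_trans ?_ h2
  rw [le_div_iff₀ (by positivity)]
  calc N * (freqBound N ν / 4) ^ (k + 1) * (N : ℝ) ^ k
      = (N * (freqBound N ν / 4)) ^ (k + 1) := by rw [mul_pow, pow_succ (N : ℝ)]; ring
    _ ≤ _ := pow_le_pow_left₀ (mul_nonneg hN0.le (by linarith [freqBound_nonneg N ν])) h1 _

end IsInvMassRoot

/-! ### Trace of the inverse mass matrix -/

theorem abs_sub_zero_le_sum (n : ℕ) (u : Fin (n + 1) → ℝ) (i : Fin (n + 1)) :
    |u i - u 0| ≤ ∑ k : Fin n, |u k.succ - u k.castSucc| := by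
  -- Clamping the index at `n` extends `u` to all of `ℕ`.
  set f : ℕ → ℝ := fun k => u ⟨min k n, by omega⟩
  have h := dist_le_range_sum_dist f i
  have hi : f i = u i := by
    have := i.is_lt
    simp only [f]
    congr 1
    ext
    simp
    omega
  have h0 : f 0 = u 0 := by simp [f]
  rw [hi, h0, dist_comm, Real.dist_eq] at h
  refine h.trans ?_
  calc ∑ k ∈ Finset.range i, dist (f k) (f (k + 1))
      ≤ ∑ k ∈ Finset.range n, dist (f k) (f (k + 1)) :=
        Finset.sum_le_sum_of_subset_of_nonneg
          (Finset.range_mono (Nat.lt_succ_iff.1 i.is_lt)) fun _ _ _ => dist_nonneg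
    _ = ∑ k : Fin n, |u k.succ - u k.castSucc| := by
        rw [Finset.sum_range]
        refine Finset.sum_congr rfl fun k _ => ?_
        have := k.is_lt
        rw [dist_comm, Real.dist_eq]
        simp only [f]
        congr 3 <;> ext <;> simp

/-- A discrete Sobolev inequality. -/
theorem mul_sq_le_sum_sq_add (N : ℕ) (u : Fin N → ℝ) (j : Fin N) :
    N * u j ^ 2 ≤ 2 * ∑ i, u i ^ 2 + 8 * ∑ i, (discGrad N *ᵥ u) i ^ 2 := by
  cases N with
  | zero => exact j.elim0
  | succ n =>
    set T : ℝ := ∑ k : Fin n, |u k.succ - u k.castSucc|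
    set G : ℝ := ∑ i, (discGrad (n + 1) *ᵥ u) i ^ 2
    have hn : (0 : ℝ) < ((n + 1 : ℕ) : ℝ) := by positivity
    have hG : G = ((n + 1 : ℕ) : ℝ) ^ 2 * ∑ k : Fin n, (u k.succ - u k.castSucc) ^ 2 := by
      rw [Finset.mul_sum]
      refine Finset.sum_congr rfl fun (i : Fin n) _ => ?_
      rw [discGrad_mulVec, one_div, div_inv_eq_mul, mul_pow, mul_comm]
      rfl
    have hT : ((n + 1 : ℕ) : ℝ) * T ^ 2 ≤ G := by
      have hcs := sq_sum_le_card_mul_sum_sq (s := Finset.univ)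
        (f := fun k : Fin n => |u k.succ - u k.castSucc|)
      simp only [sq_abs, Finset.card_univ, Fintype.card_fin] at hcs
      have hS : 0 ≤ ∑ k : Fin n, (u k.succ - u k.castSucc) ^ 2 :=
        Finset.sum_nonneg fun _ _ => sq_nonneg _
      have h2 : T ^ 2 ≤ ((n + 1 : ℕ) : ℝ) * ∑ k : Fin n, (u k.succ - u k.castSucc) ^ 2 := by
        refine hcs.trans ?_
        gcongr
        omega
      rw [hG, sq ((n + 1 : ℕ) : ℝ), mul_assoc]
      gcongr
    have hT0 : 0 ≤ T := Finset.sum_nonneg fun _ _ => abs_nonneg _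
    -- Any two values of `u` differ by at most `2T`; summing over `i` and using `N T² ≤ G` gives the
    -- claim.
    have hpt : ∀ i, u j ^ 2 ≤ 2 * u i ^ 2 + 8 * T ^ 2 := by
      intro i
      have hj := abs_le.1 (abs_sub_zero_le_sum n u j)
      have hi := abs_le.1 (abs_sub_zero_le_sum n u i)
      have hd : (u j - u i) ^ 2 ≤ (2 * T) ^ 2 :=
        sq_le_sq' (by linarith [hj.1, hi.2]) (by linarith [hj.2, hi.1])
      nlinarith [sq_nonneg (u j - 2 * u i)]
    have hsum := Finset.sum_le_sum fun i (_ : i ∈ Finset.univ) => hpt i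
    rw [Finset.sum_add_distrib, ← Finset.mul_sum] at hsum
    simp only [Finset.sum_const, Finset.card_univ, Fintype.card_fin, nsmul_eq_mul] at hsum
    linarith

/-- The Green function `u = M⁻¹ e_j` satisfies `u·Mu = u_j`. The Sobolev inequality then gives `N
u_j² ≤ (2 + 8/ν²) u_j`, and `u_j > 0` can be divided out. -/
theorem trace_inv_massMatrix_le (N : ℕ) {ν : ℝ} (hν : 0 < ν) :
    (massMatrix N ν)⁻¹.trace ≤ 2 + 8 / ν ^ 2 := by
  set M := massMatrix N ν
  have hdiag : ∀ j, N * M⁻¹ j j ≤ 2 + 8 / ν ^ 2 := by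
    intro j
    set u : Fin N → ℝ := M⁻¹ *ᵥ Pi.single j 1
    have hu : u j = M⁻¹ j j := by simp [u]
    have hMu : u ⬝ᵥ (M *ᵥ u) = u j := by
      simp only [u]
      rw [Matrix.mulVec_mulVec, Matrix.mul_nonsing_inv _ (isUnit_det_massMatrix N ν),
        Matrix.one_mulVec, dotProduct_single_one]
    have hpos : 0 < u j := by
      rw [hu]
      exact (posDef_massMatrix N ν).inv.diag_pos
    have h1 := mul_sq_le_sum_sq_add N u j
    have h2 := dotProduct_massMatrix_mulVec N ν u
    rw [hMu] at h2
    have hs : 0 ≤ ∑ i, u i ^ 2 := Finset.sum_nonneg fun _ _ => sq_nonneg _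
    have hg : 0 ≤ ∑ i, (discGrad N *ᵥ u) i ^ 2 := Finset.sum_nonneg fun _ _ => sq_nonneg _
    rw [← hu]
    clear_value u
    generalize ∑ i, u i ^ 2 = S at *
    generalize ∑ i, (discGrad N *ᵥ u) i ^ 2 = G at *
    have e : (2 + 8 / ν ^ 2) * u j = 2 * S + 8 * G + (8 / ν ^ 2 * S + 2 * ν ^ 2 * G) := by
      rw [h2]
      field_simp
      ring
    have : 0 ≤ 8 / ν ^ 2 * S + 2 * ν ^ 2 * G := by positivity
    refine le_of_mul_le_mul_right ?_ hpos
    linarith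
  rcases Nat.eq_zero_or_pos N with h0 | hN
  · subst h0
    have : M⁻¹.trace = 0 := by simp [Matrix.trace]
    rw [this]
    positivity
  · have hN' : (0 : ℝ) < N := by exact_mod_cast hN
    have hs := Finset.sum_le_sum fun j (_ : j ∈ Finset.univ) => hdiag j
    rw [← Finset.mul_sum] at hs
    simp only [Finset.sum_const, Finset.card_univ, Fintype.card_fin, nsmul_eq_mul] at hs
    exact le_of_mul_le_mul_left hs hN'

namespace IsInvMassRoot

variable {N : ℕ} {ν : ℝ} {C : Matrix (Fin N) (Fin N) ℝ}

/-- This is the trace of `M⁻¹ + ν² M⁻¹ ∇ᵀ∇ = 1`. -/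
theorem sq_mul_freqMoment_one (hC : IsInvMassRoot N ν C) :
    ν ^ 2 * freqMoment N C 1 = N - (massMatrix N ν)⁻¹.trace := by
  set M := massMatrix N ν
  have h1 : freqMoment N C 1 = (M⁻¹ * ((discGrad N)ᵀ * discGrad N)).trace := by
    rw [freqMoment, pow_one, coupling, Matrix.transpose_mul, Matrix.transpose_transpose,
      Matrix.mul_assoc, Matrix.trace_mul_comm, ← hC.transpose_mul_self,
      Matrix.trace_mul_comm (Cᵀ * C)]
    simp only [Matrix.mul_assoc]
  have h2 : M⁻¹ + ν ^ 2 • (M⁻¹ * ((discGrad N)ᵀ * discGrad N)) = 1 := by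
    calc M⁻¹ + ν ^ 2 • (M⁻¹ * ((discGrad N)ᵀ * discGrad N))
        = M⁻¹ * (1 + ν ^ 2 • ((discGrad N)ᵀ * discGrad N)) := by
          rw [mul_add, mul_one, Matrix.mul_smul]
      _ = M⁻¹ * M := by rw [← massMatrix_eq]
      _ = 1 := Matrix.nonsing_inv_mul M (isUnit_det_massMatrix N ν)
  have h3 := congrArg Matrix.trace h2
  rw [Matrix.trace_add, Matrix.trace_smul, ← h1, Matrix.trace_one, Fintype.card_fin,
    smul_eq_mul] at h3
  linarith

/-- For `x = ν²ω_i² ∈ [0, 1]` one has `0 ≤ 1 - x³ ≤ 3(1 - x)`, and `∑ (1 - x) = tr M⁻¹`. -/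
theorem abs_freqMoment_three_sub_le (hC : IsInvMassRoot N ν C) (hν : 0 < ν) :
    |ν ^ 6 * freqMoment N C 3 - N| ≤ 3 * (2 + 8 / ν ^ 2) := by
  have hx0 : ∀ i, 0 ≤ ν ^ 2 * freqSq N C i := fun i =>
    mul_nonneg (sq_nonneg ν) (freqSq_nonneg i)
  have hx1 : ∀ i, ν ^ 2 * freqSq N C i ≤ 1 := fun i =>
    (mul_le_mul_of_nonneg_left (hC.freqSq_le i) (sq_nonneg ν)).trans (mul_freqBound_le_one N ν)
  have e3 : N - ν ^ 6 * freqMoment N C 3 = ∑ i, (1 - (ν ^ 2 * freqSq N C i) ^ 3) := by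
    rw [freqMoment_eq_sum, Finset.sum_sub_distrib, Finset.mul_sum]
    simp [mul_pow, ← pow_mul]
  have e1 : N - ν ^ 2 * freqMoment N C 1 = ∑ i, (1 - ν ^ 2 * freqSq N C i) := by
    rw [freqMoment_eq_sum, Finset.sum_sub_distrib, Finset.mul_sum]
    simp
  have hlow : 0 ≤ ∑ i, (1 - (ν ^ 2 * freqSq N C i) ^ 3) :=
    Finset.sum_nonneg fun i _ => sub_nonneg.2 (pow_le_one₀ (hx0 i) (hx1 i))
  have hup : ∑ i, (1 - (ν ^ 2 * freqSq N C i) ^ 3) ≤ 3 * ∑ i, (1 - ν ^ 2 * freqSq N C i) := by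
    rw [Finset.mul_sum]
    refine Finset.sum_le_sum fun i _ => ?_
    generalize hx : ν ^ 2 * freqSq N C i = x
    have h0 := hx ▸ hx0 i
    have h1 := hx ▸ hx1 i
    nlinarith [mul_nonneg (mul_nonneg h0 (sub_nonneg.2 h1)) (by linarith : 0 ≤ 1 + x),
      mul_nonneg h0 (sub_nonneg.2 h1)]
  have ht := trace_inv_massMatrix_le N hν
  have h1 := hC.sq_mul_freqMoment_one
  rw [abs_sub_comm, abs_of_nonneg (by rw [e3]; exact hlow)]
  linarith

end IsInvMassRoot

/-! ### The chain without mass penalization -/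

/-- The adjacency matrix of the path with `n` vertices. -/
def pathAdj (n : ℕ) : Matrix (Fin n) (Fin n) ℝ :=
  Matrix.of fun i j => (if (j : ℕ) = i + 1 then 1 else 0) + (if (i : ℕ) = j + 1 then 1 else 0)

theorem discGrad_mul_transpose (N : ℕ) :
    discGrad N * (discGrad N)ᵀ =
      (N : ℝ) ^ 2 • ((2 : ℝ) • (1 : Matrix (Fin (N - 1)) (Fin (N - 1)) ℝ) - pathAdj (N - 1)) := by
  ext i j
  rw [discGrad_mul_transpose_apply]
  simp [pathAdj, Matrix.one_apply]

theorem trace_pathAdj (n : ℕ) : (pathAdj n).trace = 0 := by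
  simp [Matrix.trace, pathAdj]

/-- Closed walks of length two are the `m` edges, each counted from both ends. -/
theorem trace_pathAdj_sq (m : ℕ) : (pathAdj (m + 1) * pathAdj (m + 1)).trace = 2 * m := by
  have key : ∑ i : Fin (m + 1), ∑ j : Fin (m + 1), (if (i : ℕ) = j + 1 then (1 : ℝ) else 0) = m := by
    rw [Fin.sum_univ_succ]
    have h : ∀ k : Fin m, ∑ j : Fin (m + 1),
        (if ((k.succ : Fin (m + 1)) : ℕ) = j + 1 then (1 : ℝ) else 0) = 1 := by
      intro k
      rw [Finset.sum_eq_single k.castSucc]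
      · simp
      · intro j _ hj
        rw [if_neg]
        intro h
        apply hj
        ext
        simpa using h.symm
      · simp
    simp only [h]
    simp
  have hsq : ∀ i j : Fin (m + 1), pathAdj (m + 1) i j * pathAdj (m + 1) j i =
      (if (j : ℕ) = i + 1 then (1 : ℝ) else 0) + (if (i : ℕ) = j + 1 then 1 else 0) := by
    intro i j
    simp only [pathAdj, Matrix.of_apply]
    split_ifs <;> first | omega | norm_num
  rw [Matrix.trace]
  simp only [Matrix.diag_apply, Matrix.mul_apply, hsq, Finset.sum_add_distrib]
  rw [key, Finset.sum_comm, key]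
  ring

/-- The path is bipartite: the alternating sign matrix `J` conjugates the adjacency matrix to its
opposite. -/
theorem trace_pathAdj_cube (n : ℕ) : (pathAdj n ^ 3).trace = 0 := by
  set J : Matrix (Fin n) (Fin n) ℝ := Matrix.diagonal fun i => (-1) ^ (i : ℕ)
  have hJ : J * J = 1 := by
    rw [Matrix.diagonal_mul_diagonal, ← Matrix.diagonal_one]
    congr 1
    ext i
    rw [← mul_pow]
    simp
  have hA : J * pathAdj n = -(pathAdj n * J) := by
    ext i j
    rw [Matrix.diagonal_mul, Matrix.neg_apply, Matrix.mul_diagonal]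
    simp only [pathAdj, Matrix.of_apply]
    split_ifs with h1 h2 h2
    · omega
    · rw [h1, pow_succ]; ring
    · rw [h2, pow_succ]; ring
    · ring
  have h3 : J * pathAdj n ^ 3 = -(pathAdj n ^ 3 * J) := by
    have : J * pathAdj n ^ 3 = J * pathAdj n * pathAdj n * pathAdj n := by
      simp only [pow_succ, pow_zero, one_mul, mul_assoc]
    rw [this, hA, neg_mul, mul_assoc (pathAdj n) J, hA, mul_neg, neg_neg, mul_assoc (pathAdj n),
      mul_assoc (pathAdj n) J, hA, mul_neg, mul_neg]
    simp only [pow_succ, pow_zero, one_mul, mul_assoc]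
  have h4 : (pathAdj n ^ 3).trace = -(pathAdj n ^ 3).trace := by
    calc (pathAdj n ^ 3).trace = (J * pathAdj n ^ 3 * J).trace := by
          rw [Matrix.trace_mul_comm, ← mul_assoc, hJ, one_mul]
      _ = _ := by rw [h3, neg_mul, mul_assoc, hJ, mul_one, Matrix.trace_neg]
  linarith

/-- Expanding `tr (2 - A)³` on `N - 1` vertices gives `8(N - 1) + 6 · 2(N - 2)`. At `N = 1` the
moment is 0 and the formula fails. -/
theorem IsInvMassRoot.freqMoment_three_eq {N : ℕ} {C : Matrix (Fin N) (Fin N) ℝ}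
    (hC : IsInvMassRoot N 0 C) (hN : 2 ≤ N) :
    freqMoment N C 3 = (N : ℝ) ^ 6 * (20 * N - 32) := by
  have hM : massMatrix N 0 = 1 := by simp [massMatrix]
  have hCC : Cᵀ * C = 1 := by rw [hC.transpose_mul_self, hM, inv_one]
  have hG : (coupling N C)ᵀ * coupling N C = discGrad N * (discGrad N)ᵀ := by
    rw [coupling, Matrix.transpose_mul, Matrix.transpose_transpose, Matrix.mul_assoc,
      ← Matrix.mul_assoc Cᵀ, hCC, Matrix.one_mul]
  rw [freqMoment, trace_mul_pow_comm _ _ 2, hG, discGrad_mul_transpose]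
  obtain ⟨m, rfl⟩ : ∃ m, N = m + 2 := ⟨N - 2, by omega⟩
  change ((((m + 2 : ℕ) : ℝ) ^ 2 • ((2 : ℝ) • (1 : Matrix (Fin (m + 1)) (Fin (m + 1)) ℝ) -
    pathAdj (m + 1))) ^ 3).trace = _
  set A := pathAdj (m + 1)
  have e : ((2 : ℝ) • (1 : Matrix (Fin (m + 1)) (Fin (m + 1)) ℝ) - A) ^ 3 =
      (8 : ℝ) • 1 - (12 : ℝ) • A + (6 : ℝ) • (A * A) - A ^ 3 := by
    simp only [pow_succ, pow_zero, one_mul, mul_sub, sub_mul, Matrix.smul_mul, Matrix.mul_smul,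
      mul_one]
    module
  rw [smul_pow, Matrix.trace_smul, e]
  simp only [Matrix.trace_sub, Matrix.trace_add, Matrix.trace_smul, Matrix.trace_one, A,
    trace_pathAdj, trace_pathAdj_sq, trace_pathAdj_cube, Fintype.card_fin, smul_eq_mul]
  push_cast
  ring

/-! ### Normal coordinates -/

/-- The coordinates `(C p, r)`, in which the Hamiltonian is half the squared Euclidean norm. -/
noncomputable def unitMass {N : ℕ} (C : Matrix (Fin N) (Fin N) ℝ) (y : ReducedPhase N) :
    Fin N ⊕ Fin (N - 1) → ℝ :=
  Sum.elim (C *ᵥ y.1) y.2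

theorem unitMass_add {N : ℕ} (C : Matrix (Fin N) (Fin N) ℝ) (y y' : ReducedPhase N) :
    unitMass C (y + y') = unitMass C y + unitMass C y' := by
  ext (i | i) <;> simp [unitMass, Matrix.mulVec_add]

theorem unitMass_smul {N : ℕ} (C : Matrix (Fin N) (Fin N) ℝ) (c : ℝ) (y : ReducedPhase N) :
    unitMass C (c • y) = c • unitMass C y := by
  ext (i | i) <;> simp [unitMass, Matrix.mulVec_smul]

/-- The nilpotent matrix that generates the leapfrog step in the coordinates `unitMass`. -/
noncomputable def kick (N : ℕ) (C : Matrix (Fin N) (Fin N) ℝ) (dt : ℝ) :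
    Matrix (Fin N ⊕ Fin (N - 1)) (Fin N ⊕ Fin (N - 1)) ℝ :=
  Matrix.fromBlocks 0 (dt • coupling N C) 0 0

theorem kick_mul_self (N : ℕ) (C : Matrix (Fin N) (Fin N) ℝ) (dt : ℝ) :
    kick N C dt * kick N C dt = 0 := by
  simp [kick, Matrix.fromBlocks_multiply]

theorem kick_transpose (N : ℕ) (C : Matrix (Fin N) (Fin N) ℝ) (dt : ℝ) :
    (kick N C dt)ᵀ = Matrix.fromBlocks 0 0 (dt • (coupling N C)ᵀ) 0 := by
  simp [kick, Matrix.fromBlocks_transpose]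

theorem trace_fromBlocks_diag {m n : Type*} [Fintype m] [Fintype n] (A : Matrix m m ℝ)
    (B : Matrix n n ℝ) : (Matrix.fromBlocks A 0 0 B).trace = A.trace + B.trace := by
  simp [Matrix.trace]

theorem trace_kick_mul_transpose_pow (N : ℕ) (C : Matrix (Fin N) (Fin N) ℝ) (dt : ℝ) (k : ℕ) :
    ((kick N C dt * (kick N C dt)ᵀ) ^ (k + 1)).trace =
      dt ^ (2 * (k + 1)) * freqMoment N C (k + 1) := by
  have h : (kick N C dt * (kick N C dt)ᵀ) ^ (k + 1) =
      Matrix.fromBlocks ((dt ^ 2 • (coupling N C * (coupling N C)ᵀ)) ^ (k + 1)) 0 0 0 := by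
    rw [kick_transpose, kick, Matrix.fromBlocks_multiply]
    induction k with
    | zero => simp [smul_smul, sq]
    | succ k ih =>
      rw [pow_succ, ih, Matrix.fromBlocks_multiply, pow_succ _ (k + 1)]
      simp [smul_smul, sq]
  rw [h, trace_fromBlocks_diag, smul_pow, Matrix.trace_smul, Matrix.trace_zero, add_zero,
    smul_eq_mul, ← pow_mul, freqMoment]

theorem sum_sq_unitMass {N : ℕ} {C : Matrix (Fin N) (Fin N) ℝ} {ν : ℝ}
    (hC : IsInvMassRoot N ν C) (y : ReducedPhase N) :
    ∑ i, unitMass C y i ^ 2 = 2 * reducedHamiltonian N ν y := by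
  rw [Fintype.sum_sum_type, reducedHamiltonian, ← hC.sum_sq_mulVec, ← Finset.sum_div]
  simp only [unitMass, Sum.elim_inl, Sum.elim_inr]
  ring

/-- As `Δ_d q = -∇ᵀ r`, a kick depends on `q` only through `r = ∇q`. -/
theorem halfKick_mulVec {N : ℕ} (C : Matrix (Fin N) (Fin N) ℝ) (dt : ℝ) (x : Phase N) :
    (1 - (1 / 2 : ℝ) • kick N C dt) *ᵥ unitMass C (reduce N x) =
      unitMass C (reduce N (x.1 + (dt / 2) • (discLaplacian N *ᵥ x.2), x.2)) := by
  rw [Matrix.sub_mulVec, Matrix.one_mulVec, Matrix.smul_mulVec, kick, unitMass,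
    Matrix.fromBlocks_mulVec, discLaplacian_eq, unitMass]
  ext (i | i)
  · simp only [reduce, coupling, Pi.sub_apply, Sum.elim_inl, Pi.smul_apply, Pi.add_apply,
      Sum.elim_comp_inl, Sum.elim_comp_inr, Matrix.zero_mul, Matrix.zero_mulVec, Pi.zero_apply,
      Matrix.mulVec_add, Matrix.mulVec_smul, Matrix.smul_mul, Matrix.smul_mulVec,
      Matrix.neg_mulVec, Matrix.mulVec_neg,
      Matrix.mulVec_mulVec, Matrix.mul_assoc, smul_eq_mul, Pi.neg_apply]
    ring
  · simp [reduce]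

/-- Since `M⁻¹ = CᵀC`, the drift `∇M⁻¹p = (C∇ᵀ)ᵀ(C p)` uses the transpose of the coupling in the
kicks. -/
theorem drift_mulVec {N : ℕ} {C : Matrix (Fin N) (Fin N) ℝ} {ν : ℝ}
    (hC : IsInvMassRoot N ν C) (dt : ℝ) (x : Phase N) :
    (1 + (kick N C dt)ᵀ) *ᵥ unitMass C (reduce N x) =
      unitMass C (reduce N (x.1, x.2 + dt • ((massMatrix N ν)⁻¹ *ᵥ x.1))) := by
  rw [Matrix.add_mulVec, Matrix.one_mulVec, kick_transpose, unitMass,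
    Matrix.fromBlocks_mulVec, unitMass, ← hC.transpose_mul_self]
  ext (i | i)
  · simp [reduce]
  · simp only [reduce, coupling, Pi.add_apply, Sum.elim_inr, Pi.smul_apply,
      Sum.elim_comp_inl, Sum.elim_comp_inr, Matrix.zero_mul, Matrix.zero_mulVec,
      add_zero, Matrix.mulVec_add, Matrix.mulVec_smul, Matrix.smul_mul, Matrix.smul_mulVec,
      Matrix.transpose_mul, Matrix.transpose_transpose,
      Matrix.mulVec_mulVec, Matrix.mul_assoc, smul_eq_mul]

theorem unitMass_leapfrog {N : ℕ} {C : Matrix (Fin N) (Fin N) ℝ} {ν : ℝ}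
    (hC : IsInvMassRoot N ν C) (dt : ℝ) (x : Phase N) :
    unitMass C (reduce N (leapfrog N ν dt x)) =
      stepMatrix (kick N C dt) *ᵥ unitMass C (reduce N x) := by
  rw [stepMatrix, ← Matrix.mulVec_mulVec, ← Matrix.mulVec_mulVec, halfKick_mulVec,
    drift_mulVec hC, halfKick_mulVec]
  rfl

theorem energyVariation_eq {N : ℕ} {C : Matrix (Fin N) (Fin N) ℝ} {ν : ℝ}
    (hC : IsInvMassRoot N ν C) (β dt : ℝ) (x : Phase N) :
    energyVariation N ν β dt x = invTemp β N * (1 / 2 * (unitMass C (reduce N x) ⬝ᵥ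
      (energyMatrix (kick N C dt) *ᵥ unitMass C (reduce N x)))) := by
  rw [dotProduct_energyMatrix_mulVec, ← unitMass_leapfrog hC, sum_sq_unitMass hC,
    sum_sq_unitMass hC, energyVariation, ← reducedHamiltonian_reduce,
    ← reducedHamiltonian_reduce]
  ring

open scoped Matrix.Norms.L2Operator in
theorem norm_kick_le {N : ℕ} {C : Matrix (Fin N) (Fin N) ℝ} {ν : ℝ}
    (hC : IsInvMassRoot N ν C) {dt : ℝ} (hdt : 0 ≤ dt) :
    ‖kick N C dt‖ ≤ dt * √(freqBound N ν) := by
  have h : ‖(kick N C dt)ᵀ‖ ≤ dt * √(freqBound N ν) := by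
    refine norm_le_of_sum_sq_le _ (by positivity) fun z => ?_
    rw [kick_transpose, Matrix.fromBlocks_mulVec, Fintype.sum_sum_type, Fintype.sum_sum_type]
    have h1 := hC.sum_sq_coupling_transpose_le (z ∘ Sum.inl)
    have h2 : 0 ≤ ∑ i, z (Sum.inr i) ^ 2 := Finset.sum_nonneg fun _ _ => sq_nonneg _
    have h3 := mul_le_mul_of_nonneg_left h1 (sq_nonneg dt)
    simp only [Sum.elim_inl, Sum.elim_inr, Matrix.zero_mulVec, add_zero, Pi.zero_apply,
      Matrix.smul_mulVec, Pi.smul_apply, smul_eq_mul, mul_pow, ← Finset.mul_sum, ne_eq,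
      OfNat.ofNat_ne_zero, not_false_eq_true, zero_pow, Finset.sum_const_zero, zero_add,
      Real.sq_sqrt (freqBound_nonneg N ν)]
    refine h3.trans ?_
    rw [← mul_assoc]
    refine mul_le_mul_of_nonneg_left ?_ (mul_nonneg (sq_nonneg _) (freqBound_nonneg N ν))
    simpa using h2
  rwa [← Matrix.conjTranspose_eq_transpose_of_trivial, Matrix.l2_opNorm_conjTranspose] at h

/-- Independent standard Gaussian coordinates of a canonically distributed state: `unitMass`
coordinates in units of the temperature, followed by the transpose of the matrix `Q`. -/
noncomputable def normalCoord {N : ℕ} (C : Matrix (Fin N) (Fin N) ℝ) (β : ℝ)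
    (Q : Matrix (Fin N ⊕ Fin (N - 1)) (Fin N ⊕ Fin (N - 1)) ℝ) :
    ReducedPhase N →ₗ[ℝ] (Fin N ⊕ Fin (N - 1) → ℝ) where
  toFun y := √(invTemp β N) • (Qᵀ *ᵥ unitMass C y)
  map_add' y y' := by
    rw [← smul_add, ← Matrix.mulVec_add, unitMass_add]
  map_smul' c y := by
    rw [RingHom.id_apply, unitMass_smul, Matrix.mulVec_smul, smul_comm]

theorem sum_sq_normalCoord {N : ℕ} {C : Matrix (Fin N) (Fin N) ℝ} {ν β : ℝ} (hβ : 0 ≤ β)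
    (hC : IsInvMassRoot N ν C) {Q : Matrix (Fin N ⊕ Fin (N - 1)) (Fin N ⊕ Fin (N - 1)) ℝ}
    (hQ : Qᵀ * Q = 1) (y : ReducedPhase N) :
    1 / 2 * ∑ i, normalCoord C β Q y i ^ 2 = invTemp β N * reducedHamiltonian N ν y := by
  have hQ' : (Qᵀ)ᵀ * Qᵀ = 1 := by
    rw [Matrix.transpose_transpose]
    exact mul_eq_one_comm.1 hQ
  have hb : 0 ≤ invTemp β N := div_nonneg hβ (Nat.cast_nonneg _)
  have h := sum_sq_mulVec_of_transpose_mul hQ' (unitMass C y)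
  rw [sum_sq_unitMass hC] at h
  simp only [normalCoord, LinearMap.coe_mk, AddHom.coe_mk, Pi.smul_apply, smul_eq_mul, mul_pow,
    Real.sq_sqrt hb, ← Finset.mul_sum, h]
  ring

theorem injective_normalCoord {N : ℕ} {C : Matrix (Fin N) (Fin N) ℝ} {ν β : ℝ} (hβ : 0 < β)
    (hN : 0 < N) (hC : IsInvMassRoot N ν C)
    {Q : Matrix (Fin N ⊕ Fin (N - 1)) (Fin N ⊕ Fin (N - 1)) ℝ} (hQ : Qᵀ * Q = 1) :
    Function.Injective (normalCoord C β Q) := by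
  rw [← LinearMap.ker_eq_bot, LinearMap.ker_eq_bot']
  intro y hy
  have hb : invTemp β N ≠ 0 := div_ne_zero hβ.ne' (Nat.cast_ne_zero.2 hN.ne')
  have h := sum_sq_normalCoord hβ.le hC hQ y
  have h0 : reducedHamiltonian N ν y = 0 := by
    rw [hy] at h
    simpa [hb] using h.symm
  have h1 := sum_sq_unitMass hC y
  rw [h0, mul_zero, Finset.sum_eq_zero_iff_of_nonneg fun _ _ => sq_nonneg _] at h1
  have h2 : ∀ i, unitMass C y i = 0 := fun i => by simpa using h1 i (Finset.mem_univ i)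
  refine Prod.ext (hC.eq_zero_of_mulVec_eq_zero (funext fun i => h2 (Sum.inl i))) ?_
  exact funext fun i => h2 (Sum.inr i)

theorem map_normalCoord {N : ℕ} {C : Matrix (Fin N) (Fin N) ℝ} {ν β : ℝ} (hβ : 0 < β)
    (hN : 0 < N) (hC : IsInvMassRoot N ν C)
    {Q : Matrix (Fin N ⊕ Fin (N - 1)) (Fin N ⊕ Fin (N - 1)) ℝ} (hQ : Qᵀ * Q = 1)
    [IsProbabilityMeasure (canonicalMeasure N ν β)] :
    (canonicalMeasure N ν β).map (normalCoord C β Q) = Measure.pi fun _ => gaussianReal 0 1 := by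
  have hdim : Module.finrank ℝ (ReducedPhase N) =
      Module.finrank ℝ (Fin N ⊕ Fin (N - 1) → ℝ) := by simp
  set e := (normalCoord C β Q).linearEquivOfInjective (injective_normalCoord hβ hN hC hQ) hdim
  have hvol : (volume : Measure (ReducedPhase N)).IsAddHaarMeasure :=
    Measure.prod.instIsAddHaarMeasure _ _
  exact map_eq_pi_gaussianReal volume e.toContinuousLinearEquiv (canonicalMeasure N ν β)
    (partitionFunction N ν β)⁻¹ (by
      have : ∀ y, e.toContinuousLinearEquiv y = normalCoord C β Q y := fun y => rfl
      simp_rw [this, sum_sq_normalCoord hβ.le hC hQ]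
      rfl)

/-- The energy variation of a canonically distributed state is a diagonal quadratic form of
independent standard Gaussian variables. -/
theorem exists_gaussian_coordinates {Ω : Type*} [MeasurableSpace Ω] {P : Measure Ω}
    [IsProbabilityMeasure P] {N : ℕ} {C : Matrix (Fin N) (Fin N) ℝ} {ν β dt : ℝ} (hβ : 0 < β)
    (hC : IsInvMassRoot N ν C) (hdt : 0 ≤ dt) {X : Ω → Phase N} (hX : IsCanonical N ν β X P) :
    ∃ (a : Fin N ⊕ Fin (N - 1) → ℝ) (w : Ω → Fin N ⊕ Fin (N - 1) → ℝ),
      AEMeasurable w P ∧ P.map w = Measure.pi (fun _ => gaussianReal 0 1) ∧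
      (∀ ω, energyVariation N ν β dt (X ω) = 1 / 2 * ∑ j, a j * w ω j ^ 2) ∧
      ∑ j, a j = dt ^ 6 / 16 * freqMoment N C 3 ∧
      ∑ j, a j ^ 2 = dt ^ 6 / 8 * freqMoment N C 3 + dt ^ 12 / 256 * freqMoment N C 6 ∧
      ∀ j, |a j| ≤ 2 * ((dt * √(freqBound N ν)) ^ 3 + (dt * √(freqBound N ν)) ^ 6) := by
  have hA := isHermitian_energyMatrix (kick N C dt)
  have hU := kick_mul_self N C dt
  set Q := hA.eigenvectorUnitary.1
  have hQ : Qᵀ * Q = 1 := transpose_eigenvectorUnitary_mul hA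
  have hred : AEMeasurable (fun ω => reduce N (X ω)) P := by
    have : Measurable (reduce N) :=
      measurable_fst.prodMk ((Continuous.matrix_mulVec continuous_const
        continuous_id).measurable.comp measurable_snd)
    exact this.comp_aemeasurable hX.aemeasurable
  have hmeas : Measurable (normalCoord C β Q) :=
    (LinearMap.continuous_of_finiteDimensional _).measurable
  have hw : AEMeasurable (fun ω => normalCoord C β Q (reduce N (X ω))) P :=
    hmeas.comp_aemeasurable hred
  refine ⟨hA.eigenvalues, fun ω => normalCoord C β Q (reduce N (X ω)), hw, ?_, ?_, ?_, ?_, ?_⟩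
  -- At `N = 0` the division `β / 0 = 0` makes the temperature degenerate, but the index set is
  -- empty.
  · rcases Nat.eq_zero_or_pos N with rfl | hN
    · have hemp : IsEmpty (Fin 0 ⊕ Fin (0 - 1)) := ⟨fun i => i.elim Fin.elim0 Fin.elim0⟩
      have : (fun ω => normalCoord C β Q (reduce 0 (X ω))) = fun _ => isEmptyElim :=
        funext fun _ => Subsingleton.elim _ _
      rw [Measure.pi_of_empty]
      rw [this, Measure.map_const, measure_univ, one_smul]
    · have : IsProbabilityMeasure (canonicalMeasure N ν β) := by
        rw [← hX.map_reduce]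
        exact Measure.isProbabilityMeasure_map hred
      rw [← map_normalCoord hβ hN hC hQ, ← hX.map_reduce,
        AEMeasurable.map_map_of_aemeasurable hmeas.aemeasurable hred]
      rfl
  · intro ω
    have hb : 0 ≤ invTemp β N := div_nonneg hβ.le (Nat.cast_nonneg _)
    rw [energyVariation_eq hC, dotProduct_mulVec_eq_sum hA, Finset.mul_sum, Finset.mul_sum,
      Finset.mul_sum]
    refine Finset.sum_congr rfl fun j _ => ?_
    simp only [normalCoord, LinearMap.coe_mk, AddHom.coe_mk, Pi.smul_apply, smul_eq_mul,
      mul_pow, Real.sq_sqrt hb]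
    ring
  · have h := trace_pow_eq_sum_eigenvalues hA 1
    simp only [pow_one] at h
    rw [← h, trace_energyMatrix hU, trace_kick_mul_transpose_pow N C dt 2]
    ring
  · rw [← trace_pow_eq_sum_eigenvalues hA 2, trace_energyMatrix_sq hU,
      trace_kick_mul_transpose_pow N C dt 2, trace_kick_mul_transpose_pow N C dt 5]
    ring
  · exact fun j => (abs_eigenvalues_le_norm hA j).trans
      (norm_energyMatrix_le hU (norm_kick_le hC hdt))

/-! ### Asymptotics -/

/-- Comparing both moments with `N κ^k` bounds the quotient by `2 (δt² κ)³`. -/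
theorem isLittleO_freqMoment_six {ν : ℝ} {C : ∀ N, Matrix (Fin N) (Fin N) ℝ}
    (hC : ∀ N, IsInvMassRoot N ν (C N)) {dt : ℕ → ℝ}
    (h : Tendsto (fun N => dt N ^ 2 * freqBound N ν) atTop (𝓝 0)) :
    (fun N => dt N ^ 12 / 512 * freqMoment N (C N) 6) =o[atTop]
      fun N => dt N ^ 6 / 16 * freqMoment N (C N) 3 := by
  have h3 : Tendsto (fun N => (dt N ^ 2 * freqBound N ν) ^ 3) atTop (𝓝 0) := by
    simpa using h.pow 3
  refine isLittleO_iff.2 fun c hc => ?_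
  filter_upwards [h3.eventually (gt_mem_nhds (show 0 < c / 2 by positivity)),
    eventually_ge_atTop 2] with N hN h2
  have hκ := freqBound_nonneg N ν
  have l6 := (hC N).freqMoment_le 6
  have l3 := (hC N).le_freqMoment h2 2
  have n3 : 0 ≤ freqMoment N (C N) 3 := IsInvMassRoot.freqMoment_nonneg 3
  have n6 : 0 ≤ freqMoment N (C N) 6 := IsInvMassRoot.freqMoment_nonneg 6
  have d12 : 0 ≤ dt N ^ 12 := Even.pow_nonneg (by decide) _
  have d6 : 0 ≤ dt N ^ 6 := Even.pow_nonneg (by decide) _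
  rw [Real.norm_of_nonneg (by positivity), Real.norm_of_nonneg (by positivity)]
  set κ := freqBound N ν
  calc dt N ^ 12 / 512 * freqMoment N (C N) 6 ≤ dt N ^ 12 / 512 * (N * κ ^ 6) := by gcongr
    _ = 2 * (dt N ^ 2 * κ) ^ 3 * (dt N ^ 6 / 16 * (N * (κ / 4) ^ (2 + 1))) := by ring
    _ ≤ 2 * (c / 2) * (dt N ^ 6 / 16 * freqMoment N (C N) 3) := by gcongr
    _ = _ := by ring

theorem isEquivalent_freqMoment_three_of_pos {ν : ℝ} (hν : 0 < ν)
    {C : ∀ N, Matrix (Fin N) (Fin N) ℝ} (hC : ∀ N, IsInvMassRoot N ν (C N)) :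
    (fun N => freqMoment N (C N) 3) ~[atTop] fun N => (N : ℝ) / ν ^ 6 := by
  have h1 : (fun N => ν ^ 6 * freqMoment N (C N) 3) ~[atTop] fun N => (N : ℝ) := by
    have hO : (fun N => ν ^ 6 * freqMoment N (C N) 3 - (N : ℝ)) =O[atTop] fun _ => (1 : ℝ) :=
      IsBigO.of_bound (3 * (2 + 8 / ν ^ 2)) (Eventually.of_forall fun N => by
        simpa using (hC N).abs_freqMoment_three_sub_le hν)
    exact hO.trans_isLittleO ((isLittleO_const_left.2 (Or.inr (by
      simpa [Function.comp_def] using tendsto_natCast_atTop_atTop (R := ℝ)))))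
  have h2 := (IsEquivalent.refl (u := fun _ : ℕ => (ν ^ 6)⁻¹) (l := atTop)).mul h1
  refine (h2.congr_left (Eventually.of_forall fun N => ?_)).congr_right
    (Eventually.of_forall fun N => ?_)
  · simp only [Pi.mul_apply]
    field_simp
  · simp only [Pi.mul_apply]
    rw [div_eq_inv_mul]

theorem isEquivalent_freqMoment_three_zero {C : ∀ N, Matrix (Fin N) (Fin N) ℝ}
    (hC : ∀ N, IsInvMassRoot N 0 (C N)) :
    (fun N => freqMoment N (C N) 3) ~[atTop] fun N => 20 * (N : ℝ) ^ 7 := by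
  have hN : Tendsto (fun N : ℕ => (N : ℝ)) atTop atTop := tendsto_natCast_atTop_atTop
  have h1 : (fun N : ℕ => 20 * (N : ℝ) - 32) ~[atTop] fun N => 20 * (N : ℝ) := by
    have hl : (fun _ : ℕ => (-32 : ℝ)) =o[atTop] fun N : ℕ => 20 * (N : ℝ) :=
      isLittleO_const_left.2 (Or.inr
        (tendsto_norm_atTop_atTop.comp (hN.const_mul_atTop (by norm_num))))
    simpa [IsEquivalent, Pi.sub_def] using hl
  have h2 := (IsEquivalent.refl (u := fun N : ℕ => (N : ℝ) ^ 6) (l := atTop)).mul h1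
  refine (h2.congr_left ?_).congr_right (Eventually.of_forall fun N => ?_)
  · filter_upwards [eventually_ge_atTop 2] with N h
    simp only [Pi.mul_apply]
    rw [(hC N).freqMoment_three_eq h]
  · simp only [Pi.mul_apply]
    ring

/-- Each coefficient of the normalized quadratic form is of order `N ^ (-1 / 2)`, uniformly in the
time step. -/
theorem sq_div_sum_sq_le {N : ℕ} (hN : 2 ≤ N) {ν : ℝ} {C : Matrix (Fin N) (Fin N) ℝ}
    (hC : IsInvMassRoot N ν C) {dt : ℝ} (hdt : 0 < dt) {a s : ℝ}
    (ha : |a| ≤ 2 * ((dt * √(freqBound N ν)) ^ 3 + (dt * √(freqBound N ν)) ^ 6))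
    (hs : s = dt ^ 6 / 8 * freqMoment N C 3 + dt ^ 12 / 256 * freqMoment N C 6) :
    0 < s ∧ a ^ 2 ≤ 2 ^ 23 / N * s := by
  have hN0 : (0 : ℝ) < N := by exact_mod_cast (by omega : 0 < N)
  have hκ := freqBound_pos (by omega : 0 < N) ν
  have l3 := hC.le_freqMoment hN 2
  have l6 := hC.le_freqMoment hN 5
  set κ := freqBound N ν
  set u := dt * √κ
  have hu : 0 < u := by positivity
  have hu2 : u ^ 2 = dt ^ 2 * κ := by rw [mul_pow, Real.sq_sqrt hκ.le]
  have b3 : N * u ^ 6 / 512 ≤ dt ^ 6 / 8 * freqMoment N C 3 := by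
    calc N * u ^ 6 / 512 = dt ^ 6 / 8 * (N * (κ / 4) ^ (2 + 1)) := by
          rw [show u ^ 6 = (u ^ 2) ^ 3 by ring, hu2]; ring
      _ ≤ _ := by gcongr
  have b6 : N * u ^ 12 / 2 ^ 20 ≤ dt ^ 12 / 256 * freqMoment N C 6 := by
    calc N * u ^ 12 / 2 ^ 20 = dt ^ 12 / 256 * (N * (κ / 4) ^ (5 + 1)) := by
          rw [show u ^ 12 = (u ^ 2) ^ 6 by ring, hu2]; ring
      _ ≤ _ := by gcongr
  -- Here `2 ^ 20 = 256 · 4⁶` is the worse of the two constants, the other being `512 = 8 · 4³`.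
  have b : N * (u ^ 6 + u ^ 12) / 2 ^ 20 ≤ s := by
    rw [hs]
    have : 0 ≤ N * u ^ 6 := by positivity
    linarith
  refine ⟨lt_of_lt_of_le (by positivity) b, ?_⟩
  calc a ^ 2 = |a| ^ 2 := (sq_abs a).symm
    _ ≤ (2 * (u ^ 3 + u ^ 6)) ^ 2 := by gcongr
    _ ≤ 8 * (u ^ 6 + u ^ 12) := by nlinarith [sq_nonneg (u ^ 3 - u ^ 6)]
    _ = 2 ^ 23 / N * (N * (u ^ 6 + u ^ 12) / 2 ^ 20) := by field_simp; norm_num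
    _ ≤ 2 ^ 23 / N * s := by gcongr

end HarmonicChain

/-! ### The central limit theorem and the two asymptotic regimes -/

open HarmonicChain in
theorem propositionp {Ω : ℕ → Type*} [∀ N, MeasurableSpace (Ω N)]
    (P : ∀ N, Measure (Ω N)) [∀ N, IsProbabilityMeasure (P N)]
    (β ν : ℝ) (hβ : 0 < β) (hν : 0 ≤ ν)
    (δt : ℕ → ℝ) (hδt : ∀ N, 0 < δt N)
    (X : ∀ N, Ω N → Phase N) (hX : ∀ N, IsCanonical N ν β (X N) (P N))
    (E : ∀ N, Ω N → ℝ) (hE : ∀ N ω, E N ω = energyVariation N ν β (δt N) (X N ω))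
    (m σ : ℕ → ℝ) (hm : ∀ N, m N = ∫ ω, E N ω ∂(P N))
    (hσ : ∀ N, σ N = Real.sqrt (Var[E N; P N])) :
    (∀ N, MemLp (E N) 2 (P N)) ∧
    TendstoInDistribution (fun N ω => (E N ω - m N) / σ N) atTop (id : ℝ → ℝ) P
      (gaussianReal 0 1) ∧
    (0 < ν → Tendsto δt atTop (𝓝 0) →
      m ~[atTop] (fun N => (N : ℝ) * δt N ^ 6 / (32 * ν ^ 6)) ∧
      (fun N => σ N ^ 2) ~[atTop] (fun N => (N : ℝ) * δt N ^ 6 / (16 * ν ^ 6))) ∧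
    (ν = 0 → δt =o[atTop] (fun N => 1 / (N : ℝ)) →
      m ~[atTop] (fun N => 5 / 8 * (N : ℝ) ^ 7 * δt N ^ 6) ∧
      (fun N => σ N ^ 2) ~[atTop] (fun N => 5 / 4 * (N : ℝ) ^ 7 * δt N ^ 6)) := by
  choose C hC using fun N => exists_isInvMassRoot N ν
  choose a w hw hlaw hEw hsum hsumsq hbound using fun N =>
    exists_gaussian_coordinates hβ (hC N) (hδt N).le (hX N)
  have hF : ∀ N ω, E N ω = 1 / 2 * ∑ j, a N j * w N ω j ^ 2 := fun N ω => by
    rw [hE, hEw]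
  have hLp : ∀ N, MemLp (E N) 2 (P N) := fun N => memLp_quadratic (hw N) (hlaw N) (hF N)
  have hm' : ∀ N, m N = δt N ^ 6 / 32 * freqMoment N (C N) 3 := fun N => by
    rw [hm, integral_quadratic (hw N) (hlaw N) (hF N), hsum]
    ring
  have hσ' : ∀ N, σ N ^ 2 =
      δt N ^ 6 / 16 * freqMoment N (C N) 3 + δt N ^ 12 / 512 * freqMoment N (C N) 6 := fun N => by
    rw [hσ, Real.sq_sqrt (variance_nonneg _ _), variance_quadratic (hw N) (hlaw N) (hF N), hsumsq]
    ring
  have hσequiv : Tendsto (fun N => δt N ^ 2 * freqBound N ν) atTop (𝓝 0) →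
      (fun N => σ N ^ 2) ~[atTop] fun N => δt N ^ 6 / 16 * freqMoment N (C N) 3 := fun h => by
    rw [funext hσ']
    exact IsEquivalent.refl.add_isLittleO (isLittleO_freqMoment_six hC h)
  refine ⟨hLp, ⟨fun N => ?_, aemeasurable_id, ?_⟩, fun hν0 hδ => ?_, fun hν0 hδ => ?_⟩
  · exact ((hLp N).aestronglyMeasurable.aemeasurable.sub_const _).div_const _
  · refine ProbabilityMeasure.tendsto_iff_tendsto_charFun.2 fun t => ?_
    simp only [ProbabilityMeasure.coe_mk, Measure.map_id]
    have hfun : ∀ N, charFun ((P N).map fun ω => (E N ω - m N) / σ N) t =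
        ∏ j, charFun ((gaussianReal 0 1).map normSq) (a N j / √(∑ j, a N j ^ 2) * t) := fun N => by
      rw [hm, hσ]
      exact charFun_normalized_quadratic (hw N) (hlaw N) (hF N) t
    simp_rw [hfun]
    have hn := measurable_normSq.aemeasurable (μ := gaussianReal 0 1)
    have hprob := Measure.isProbabilityMeasure_map hn
    refine tendsto_prod_charFun ?_ ?_ _ ?_ ?_ t
    · rw [integral_map hn (by fun_prop), integral_normSq]
    · rw [integral_map hn (by fun_prop), integral_normSq_sq]
    · filter_upwards [eventually_ge_atTop 2] with N hN
      -- Only the positivity of `∑ a_j²` is wanted here, so any index serves.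
      have hpos := (sq_div_sum_sq_le hN (hC N) (hδt N)
        (hbound N (Sum.inl ⟨0, by omega⟩)) (hsumsq N)).1
      simp_rw [div_pow, Real.sq_sqrt hpos.le]
      rw [← Finset.sum_div, div_self hpos.ne']
    · intro ε hε
      have hlim : Tendsto (fun N : ℕ => (2 : ℝ) ^ 23 / N) atTop (𝓝 0) :=
        tendsto_const_div_atTop_nhds_zero_nat _
      filter_upwards [eventually_ge_atTop 2,
        hlim.eventually (gt_mem_nhds (show 0 < ε ^ 2 by positivity))] with N hN hNε j
      obtain ⟨hpos, hle⟩ := sq_div_sum_sq_le hN (hC N) (hδt N) (hbound N j) (hsumsq N)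
      refine abs_le_of_sq_le_sq ?_ hε.le
      rw [div_pow, Real.sq_sqrt hpos.le, div_le_iff₀ hpos]
      exact hle.trans (by gcongr)
  · have h3 := isEquivalent_freqMoment_three_of_pos hν0 hC
    have hκ : Tendsto (fun N => δt N ^ 2 * freqBound N ν) atTop (𝓝 0) := by
      have hub : Tendsto (fun N => δt N ^ 2 * (1 / ν ^ 2)) atTop (𝓝 0) := by
        have h := (hδ.pow 2).mul_const (1 / ν ^ 2)
        rwa [zero_pow two_ne_zero, zero_mul] at h
      refine squeeze_zero (fun N => mul_nonneg (sq_nonneg _) (freqBound_nonneg N ν))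
        (fun N => ?_) hub
      have := mul_freqBound_le_one N ν
      gcongr
      rw [le_div_iff₀ (by positivity)]
      linarith
    constructor
    · rw [funext hm']
      refine ((IsEquivalent.refl (u := fun N => δt N ^ 6 / 32)).mul h3).congr_right
        (Eventually.of_forall fun N => ?_)
      simp only [Pi.mul_apply]
      ring
    · refine (hσequiv hκ).trans (((IsEquivalent.refl (u := fun N => δt N ^ 6 / 16)).mul
        h3).congr_right (Eventually.of_forall fun N => ?_))
      simp only [Pi.mul_apply]
      ring
  · subst hν0
    have h3 := isEquivalent_freqMoment_three_zero hC
    -- For `ν = 0` the frequency bound is `4N²`, which is where `δt = o(1/N)` enters.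
    have hκ : Tendsto (fun N => δt N ^ 2 * freqBound N 0) atTop (𝓝 0) := by
      have h1 := hδ.tendsto_div_nhds_zero
      have h2 : Tendsto (fun N => 4 * (δt N / (1 / (N : ℝ))) ^ 2) atTop (𝓝 0) := by
        simpa using (h1.pow 2).const_mul 4
      refine h2.congr fun N => ?_
      simp only [freqBound, one_div, div_inv_eq_mul]
      ring
    constructor
    · rw [funext hm']
      refine ((IsEquivalent.refl (u := fun N => δt N ^ 6 / 32)).mul h3).congr_right
        (Eventually.of_forall fun N => ?_)
      simp only [Pi.mul_apply]
      ring
    · refine (hσequiv hκ).trans (((IsEquivalent.refl (u := fun N => δt N ^ 6 / 16)).mul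
        h3).congr_right (Eventually.of_forall fun N => ?_))
      simp only [Pi.mul_apply]
      ring
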